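/- Let $\Sigma\subset\mathbb R^3$ be one of the standard models of the simply connected complete surfaces of constant curvature $K\in\{0,1,-1\}$: the plane $\{x_3=1\}$ ($K=0$), the unit sphere $\{x_1^2+x_2^2+x_3^2=1\}$ ($K=1$), or the hyperbolic plane $\{x_1^2+x_2^2-x_3^2=-1,\ x_3>0\}$ ($K=-1$), with the metric induced by the quadratic form $x_1^2+x_2^2+Kx_3^2$. Geodesics of $\Sigma$ are its nonempty intersections with two-dimensional vector subspaces of $\mathbb R^3$. A (nondegenerate) conic on $\Sigma$ is an intersection $\Sigma\cap\{x:\langle Cx,x\rangle=0\}$, where $C$ is a real symmetric $3\times3$ matrix with $\det C\ne0$. A germ of regular $C^2$-smooth curve $\gamma\subset\Sigma$ at a point $O$, with non-zero geodesic curvature, has the tangent incidence property if the following holds for any three distinct points $A',B',C'\in\gamma$ close enough to $O$. Let $a,b,c$ be the geodesics tangent to $\gamma$ at $A',B',C'$. Then $b\cap c$, $c\cap a$, $a\cap b$ are single points $A$, $B$, $C$, and the three geodesics $AA'$, $BB'$, $CC'$ intersect at one point. (On the sphere, a pair of antipodal points is counted as one point.) **Theorem 4.9.** For every nondegenerate conic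 on $\Sigma$ and every point $O$ of it, the germ of the conic at $O$ is a germ of regular $C^2$-smooth curve with non-zero geodesic curvature, and it has the tangent incidence property. Conversely, every germ of regular $C^2$-smooth curve on $\Sigma$ with non-zero geodesic curvature that has the tangent incidence property is a germ of a nondegenerate conic. -/

import Mathlib

open Filter Topology

noncomputable section

namespace ConstCurv

/-- The simply connected complete surfaces of constant curvature `0`, `1`, `-1`. -/
inductive Model where
  | euclidean
  | sphere
  | hyperbolic

/-- The curvature of the model. -/
def Model.curv : Model → ℝ
  | .euclidean => 0
  | .sphere => 1
  | .hyperbolic => -1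

/-- The bilinear form `⟨Q x, y⟩` on `ℝ³`, `Q = diag(1, 1, K)`; it induces the metric of the
surface. -/
def Model.form (M : Model) (x y : Fin 3 → ℝ) : ℝ :=
  x 0 * y 0 + x 1 * y 1 + M.curv * (x 2 * y 2)

/-- The standard models in `ℝ³`: the plane `x₃ = 1`, the unit sphere, and the upper sheet of the
hyperboloid `x₁² + x₂² - x₃² = -1`. -/
def Model.surface : Model → Set (Fin 3 → ℝ)
  | .euclidean => {x | x 2 = 1}
  | .sphere => {x | x 0 ^ 2 + x 1 ^ 2 + x 2 ^ 2 = 1}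
  | .hyperbolic => {x | x 0 ^ 2 + x 1 ^ 2 - x 2 ^ 2 = -1 ∧ 0 < x 2}

/-- The intersection of the surface with the vector subspace spanned by `P` and `w`. For two
distinct non-antipodal points `P`, `w` of the surface this is the geodesic through `P` and `w`; for
a point `P` and a nonzero tangent vector `w` at `P` it is the geodesic through `P` with
direction `w`. -/
def Model.geodesic (M : Model) (P w : Fin 3 → ℝ) : Set (Fin 3 → ℝ) :=
  {x | x ∈ M.surface ∧ x ∈ Submodule.span ℝ {P, w}}

/-- The set `S` is a single point `X` of the surface, where on the sphere a pair of antipodal points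
counts as one point (two great circles meet in such a pair; in the other two models `-X` is not on
the surface). -/
def Model.IsOnePoint (M : Model) (S : Set (Fin 3 → ℝ)) (X : Fin 3 → ℝ) : Prop :=
  X ∈ M.surface ∧ S = {Y | Y ∈ M.surface ∧ (Y = X ∨ Y = -X)}

/-- The conic on the surface cut out by the quadric `⟨C x, x⟩ = 0`. -/
def Model.conic (M : Model) (C : Matrix (Fin 3) (Fin 3) ℝ) : Set (Fin 3 → ℝ) :=
  {x | x ∈ M.surface ∧ (C.mulVec x) ⬝ᵥ x = 0}

/-- The covariant derivative of the velocity of `c` along `c`: the component of the acceleration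
in `ℝ³` that is tangent to the surface, `c'' - K ⟨Q c'', c⟩ c`. (The normal of the sphere and of the
hyperboloid at `x` is `x` itself, with `⟨Q x, x⟩ = K`.) -/
def Model.covAccel (M : Model) (c : ℝ → Fin 3 → ℝ) (t : ℝ) : Fin 3 → ℝ :=
  deriv (deriv c) t - (M.curv * M.form (deriv (deriv c) t) (c t)) • c t

/-- The (unsigned) geodesic curvature of a curve on the surface, in an arbitrary regular
parametrization: `|c' ∧ D c'| / |c'|³`, where `D c'` is the covariant derivative of the velocity and
lengths and areas are those of the induced metric. -/
def Model.geodesicCurvature (M : Model) (c : ℝ → Fin 3 → ℝ) (t : ℝ) : ℝ :=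
  √(M.form (deriv c t) (deriv c t) * M.form (M.covAccel c t) (M.covAccel c t)
      - M.form (deriv c t) (M.covAccel c t) ^ 2)
    / √(M.form (deriv c t) (deriv c t)) ^ 3

/-- The map `c` is a regular `C²` parametrization near `t = 0` of the germ at `O` of the curve
`γ` on the surface: the germs at `O` of `γ` and of the image of each small interval around `0`
coincide. -/
structure Model.IsC2Param (M : Model) (γ : Set (Fin 3 → ℝ)) (O : Fin 3 → ℝ)
    (c : ℝ → Fin 3 → ℝ) : Prop where
  base : c 0 = O
  contDiffAt : ContDiffAt ℝ 2 c 0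
  regular : deriv c 0 ≠ 0
  mem_surface : ∀ᶠ t in 𝓝 (0 : ℝ), c t ∈ M.surface
  germ_eq : ∀ᶠ δ in 𝓝[>] (0 : ℝ), c '' Set.Ioo (-δ) δ =ᶠ[𝓝 O] γ

/-- The incidence condition at the curve points `c s`, `c t`, `c u` (that is `A'`, `B'`, `C'`), with
tangent geodesics `a`, `b`, `c` there: `b ∩ c`, `c ∩ a`, `a ∩ b` are single points `A`, `B`, `C`, and
the geodesics `AA'`, `BB'`, `CC'` intersect at one point. -/
def Model.TangentIncidenceAt (M : Model) (c : ℝ → Fin 3 → ℝ) (s t u : ℝ) : Prop :=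
  ∃ A B C X : Fin 3 → ℝ,
    M.IsOnePoint (M.geodesic (c t) (deriv c t) ∩ M.geodesic (c u) (deriv c u)) A ∧
    M.IsOnePoint (M.geodesic (c u) (deriv c u) ∩ M.geodesic (c s) (deriv c s)) B ∧
    M.IsOnePoint (M.geodesic (c s) (deriv c s) ∩ M.geodesic (c t) (deriv c t)) C ∧
    M.IsOnePoint (M.geodesic A (c s) ∩ M.geodesic B (c t) ∩ M.geodesic C (c u)) X

/-- The germ at `O` of the subset `γ` of the surface is a germ of regular `C²` curve with nonzero
geodesic curvature that has the tangent incidence property: the incidence condition holds for all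
triples of distinct points of `γ` close enough to `O`. -/
def Model.HasTangentIncidence (M : Model) (γ : Set (Fin 3 → ℝ)) (O : Fin 3 → ℝ) : Prop :=
  ∃ c : ℝ → Fin 3 → ℝ, M.IsC2Param γ O c ∧ M.geodesicCurvature c 0 ≠ 0 ∧
    ∃ δ > 0, ∀ s ∈ Set.Ioo (-δ) δ, ∀ t ∈ Set.Ioo (-δ) δ, ∀ u ∈ Set.Ioo (-δ) δ,
      c s ≠ c t → c t ≠ c u → c u ≠ c s → M.TangentIncidenceAt c s t u

end ConstCurv

end

/-! Everything is projective: geodesics are planes through the origin, conics are quadratic cones,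
and a point of the surface may be replaced by any positive multiple.

A nondegenerate conic through `O` becomes `y₁² = y₀y₂`, parametrized by `(1, t, t²)`. The tangents
at `t` and `u` meet at `(1, (t+u)/2, tu)`, and the three lines of the incidence property meet at the
mean of the points with parameters `s`, `t`, `u` and weights `(t-u)²`, `(u-s)²`, `(s-t)²`. For small
parameters all these vectors are near the ray of `O`, so they project to actual points of the
surface.

Conversely, let `l s` be a covector defining the tangent plane at `c s`, and `φ(s,t) = l s ⬝ᵥ c t`.
Nonzero curvature is the independence of `c`, `c'`, `c''`, so convexity gives `φ(s,t) > 0` for `s ≠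
t` (`exists_forall_dotProduct_pos`). Incidence gives Ceva's identity `φ(t,s)φ(u,t)φ(s,u) =
φ(u,s)φ(s,t)φ(t,u)` (`Model.TangentIncidenceAt.ceva`). For a fixed `u`, rescaling `l s` by
`φ(u,s)/φ(s,u)` therefore makes `φ` symmetric. Then one symmetric matrix `S` sends every `c s` to `l
s`, and `l s ⬝ᵥ c s = 0` puts the curve on the conic of `S` (`exists_conic_of_symm`). No
differential equation is needed. -/

namespace ConstCurv

open Matrix

/-! ### The cone over the surface and central projection -/

/-- The quadratic form that equals `1` on the surface. -/
def Model.radial : Model → (Fin 3 → ℝ) → ℝ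
  | .euclidean, x => x 2 ^ 2
  | .sphere, x => x 0 ^ 2 + x 1 ^ 2 + x 2 ^ 2
  | .hyperbolic, x => x 2 ^ 2 - x 0 ^ 2 - x 1 ^ 2

/-- The open cone of positive multiples of points of the surface. -/
def Model.cone : Model → Set (Fin 3 → ℝ)
  | .euclidean => {x | 0 < x 2}
  | .sphere => {x | 0 < x 0 ^ 2 + x 1 ^ 2 + x 2 ^ 2}
  | .hyperbolic => {x | 0 < x 2 ^ 2 - x 0 ^ 2 - x 1 ^ 2 ∧ 0 < x 2}

/-- The central projection of the cone to the surface. -/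
noncomputable def Model.proj (M : Model) (x : Fin 3 → ℝ) : Fin 3 → ℝ :=
  (√(M.radial x))⁻¹ • x

theorem Model.mem_surface_iff (M : Model) (x : Fin 3 → ℝ) :
    x ∈ M.surface ↔ x ∈ M.cone ∧ M.radial x = 1 := by
  cases M
  · simp only [Model.surface, Model.cone, Model.radial, Set.mem_ofPred_eq]
    constructor
    · intro h; rw [h]; norm_num
    · rintro ⟨h, h'⟩; nlinarith
  · simp only [Model.surface, Model.cone, Model.radial, Set.mem_ofPred_eq]
    constructor
    · intro h; rw [h]; norm_num
    · rintro ⟨h, h'⟩; exact h'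
  · simp only [Model.surface, Model.cone, Model.radial, Set.mem_ofPred_eq]
    constructor
    · rintro ⟨h, h'⟩; exact ⟨⟨by linarith, h'⟩, by linarith⟩
    · rintro ⟨⟨h1, h2⟩, h'⟩; exact ⟨by linarith, h2⟩

theorem Model.radial_pos {M : Model} {x : Fin 3 → ℝ} (h : x ∈ M.cone) : 0 < M.radial x := by
  cases M
  · exact pow_pos h 2
  · exact h
  · exact h.1

theorem Model.radial_smul (M : Model) (k : ℝ) (x : Fin 3 → ℝ) :
    M.radial (k • x) = k ^ 2 * M.radial x := by
  cases M <;> simp [Model.radial] <;> ring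

theorem Model.smul_mem_cone {M : Model} {k : ℝ} (hk : 0 < k) {x : Fin 3 → ℝ} (h : x ∈ M.cone) :
    k • x ∈ M.cone := by
  have h2 : 0 < M.radial (k • x) := by
    have := Model.radial_pos h
    rw [M.radial_smul]
    positivity
  cases M
  · exact mul_pos hk h
  · exact h2
  · exact ⟨h2, mul_pos hk h.2⟩

theorem Model.isOpen_cone (M : Model) : IsOpen M.cone := by
  have h (i : Fin 3) : Continuous (fun x : Fin 3 → ℝ => x i) := continuous_apply i
  cases M
  · exact isOpen_lt continuous_const (h 2)
  · exact isOpen_lt continuous_const ((((h 0).pow 2).add ((h 1).pow 2)).add ((h 2).pow 2))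
  · exact (isOpen_lt continuous_const ((((h 2).pow 2).sub ((h 0).pow 2)).sub ((h 1).pow 2))).inter
      (isOpen_lt continuous_const (h 2))

theorem Model.contDiff_radial (M : Model) : ContDiff ℝ 2 M.radial := by
  have h (i : Fin 3) : ContDiff ℝ 2 (fun x : Fin 3 → ℝ => x i) := contDiff_apply ℝ ℝ i
  cases M
  · exact (h 2).pow 2
  · exact (((h 0).pow 2).add ((h 1).pow 2)).add ((h 2).pow 2)
  · exact (((h 2).pow 2).sub ((h 0).pow 2)).sub ((h 1).pow 2)

theorem Model.mem_cone {M : Model} {x : Fin 3 → ℝ} (h : x ∈ M.surface) : x ∈ M.cone :=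
  ((M.mem_surface_iff x).1 h).1

theorem Model.radial_eq_one {M : Model} {x : Fin 3 → ℝ} (h : x ∈ M.surface) : M.radial x = 1 :=
  ((M.mem_surface_iff x).1 h).2

theorem Model.ne_zero_of_mem_surface {M : Model} {x : Fin 3 → ℝ} (h : x ∈ M.surface) : x ≠ 0 := by
  rintro rfl
  have h1 := Model.radial_eq_one h
  have h2 := M.radial_smul 0 0
  rw [smul_zero, h1] at h2
  norm_num at h2

theorem Model.proj_mem {M : Model} {x : Fin 3 → ℝ} (h : x ∈ M.cone) : M.proj x ∈ M.surface := by
  have h2 := Model.radial_pos h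
  rw [Model.mem_surface_iff]
  refine ⟨Model.smul_mem_cone (by positivity) h, ?_⟩
  rw [Model.proj, Model.radial_smul, inv_pow, Real.sq_sqrt h2.le]
  exact inv_mul_cancel₀ h2.ne'

theorem Model.proj_eq_self {M : Model} {x : Fin 3 → ℝ} (h : x ∈ M.surface) : M.proj x = x := by
  simp [Model.proj, Model.radial_eq_one h]

theorem Model.proj_smul (M : Model) {k : ℝ} (hk : 0 < k) (x : Fin 3 → ℝ) :
    M.proj (k • x) = M.proj x := by
  rw [Model.proj, Model.proj, Model.radial_smul, Real.sqrt_mul (sq_nonneg k), Real.sqrt_sq hk.le,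
    smul_smul, mul_inv, mul_right_comm, inv_mul_cancel₀ hk.ne', one_mul]

/-- The radial form is homogeneous of degree two and equals `1` on the surface, so a line through
the origin meets the surface at most in `X` and `-X`. This reduces one-point claims to linear
algebra. -/
theorem Model.isOnePoint_of_forall {M : Model} {S : Set (Fin 3 → ℝ)} {X : Fin 3 → ℝ}
    (hX : X ∈ M.surface) (h : ∀ Y, Y ∈ S ↔ Y ∈ M.surface ∧ ∃ k : ℝ, Y = k • X) :
    M.IsOnePoint S X := by
  refine ⟨hX, Set.ext fun Y => ?_⟩
  rw [h]
  refine and_congr_right fun hY => ⟨?_, ?_⟩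
  · rintro ⟨k, rfl⟩
    have h1 := Model.radial_eq_one hY
    rw [Model.radial_smul, Model.radial_eq_one hX, mul_one] at h1
    rcases sq_eq_one_iff.1 h1 with rfl | rfl
    · exact Or.inl (one_smul _ _)
    · exact Or.inr (by simp)
  · rintro (rfl | rfl)
    · exact ⟨1, (one_smul _ _).symm⟩
    · exact ⟨-1, by simp⟩

theorem Model.IsOnePoint.mem {M : Model} {S : Set (Fin 3 → ℝ)} {X : Fin 3 → ℝ}
    (h : M.IsOnePoint S X) : X ∈ S := by
  rw [h.2]
  exact ⟨h.1, Or.inl rfl⟩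

/-! ### Geodesic curvature as a determinant: the algebra -/

/-- The determinant of three vectors of `ℝ³`. -/
def det3 (a b c : Fin 3 → ℝ) : ℝ := crossProduct a b ⬝ᵥ c

theorem det3_eq (a b c : Fin 3 → ℝ) :
    det3 a b c = (a 1 * b 2 - a 2 * b 1) * c 0 + (a 2 * b 0 - a 0 * b 2) * c 1
      + (a 0 * b 1 - a 1 * b 0) * c 2 := by
  rw [det3, Matrix.vec3_dotProduct, cross_apply]
  rfl

theorem det3_mulVec (E : Matrix (Fin 3) (Fin 3) ℝ) (a b c : Fin 3 → ℝ) :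
    det3 (E.mulVec a) (E.mulVec b) (E.mulVec c) = E.det * det3 a b c := by
  simp only [det3_eq, Matrix.det_fin_three, Matrix.mulVec, dotProduct, Fin.sum_univ_three]
  ring

/-- The Gram determinant of velocity and covariant acceleration is the square of the determinant of
position, velocity and acceleration. -/
theorem Model.gram_eq_det3_sq (M : Model) {p v w : Fin 3 → ℝ} (hp : p ∈ M.surface)
    (hv : M.curv * M.form p v = 0 ∧ (M = .euclidean → v 2 = 0)) (hw : M = .euclidean → w 2 = 0) :
    M.form v v * M.form (w - (M.curv * M.form w p) • p) (w - (M.curv * M.form w p) • p)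
      - M.form v (w - (M.curv * M.form w p) • p) ^ 2 = det3 p v w ^ 2 := by
  have key (K : ℝ) (hK : K * K = 1) (hM : M.curv = K) (hp : M.form p p = K) :
      M.form v v * M.form (w - (M.curv * M.form w p) • p) (w - (M.curv * M.form w p) • p)
        - M.form v (w - (M.curv * M.form w p) • p) ^ 2 = det3 p v w ^ 2 := by
    have e1 (k : ℝ) : M.form v (w - k • p) = M.form v w - k * M.form p v := by
      simp [Model.form]; ring
    have e2 (k : ℝ) : M.form (w - k • p) (w - k • p)
        = M.form w w - 2 * k * M.form w p + k ^ 2 * M.form p p := by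
      simp [Model.form]; ring
    -- The Gram determinant of `p, v, w` for the form is `det Q = K` times the squared determinant.
    have e3 : K * det3 p v w ^ 2 = M.form p p * (M.form v v * M.form w w - M.form v w ^ 2)
        - M.form p v * (M.form p v * M.form w w - M.form v w * M.form w p)
        + M.form w p * (M.form p v * M.form v w - M.form v v * M.form w p) := by
      simp only [det3_eq, Model.form, hM]
      have : K = 1 ∨ K = -1 := mul_self_eq_one_iff.1 hK
      rcases this with rfl | rfl <;> ring
    have e4 : M.form p v = 0 := by
      refine (mul_eq_zero.1 hv.1).resolve_left fun h => ?_
      rw [← hM, h] at hK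
      norm_num at hK
    rw [e1, e2, hp, hM, e4]
    rw [hp, e4] at e3
    rcases mul_self_eq_one_iff.1 hK with rfl | rfl
    · linear_combination -e3
    · linear_combination e3
  cases M
  · have h0 : p 2 = 1 := hp
    have h1 : v 2 = 0 := hv.2 rfl
    have h2 : w 2 = 0 := hw rfl
    simp only [det3_eq, Model.form, Model.curv, h0, h1, h2, Pi.sub_apply, Pi.smul_apply]
    simp
    ring
  · refine key 1 (by norm_num) rfl ?_
    have h : p 0 ^ 2 + p 1 ^ 2 + p 2 ^ 2 = 1 := hp
    simp only [Model.form, Model.curv]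
    linear_combination h
  · refine key (-1) (by norm_num) rfl ?_
    have h : p 0 ^ 2 + p 1 ^ 2 - p 2 ^ 2 = -1 := hp.1
    simp only [Model.form, Model.curv]
    linear_combination h

/-- Tangent vectors are spacelike. -/
theorem Model.form_self_pos (M : Model) {p v : Fin 3 → ℝ} (hp : p ∈ M.surface)
    (hv : M.curv * M.form p v = 0 ∧ (M = .euclidean → v 2 = 0)) (h0 : v ≠ 0) : 0 < M.form v v := by
  have h : v 0 ≠ 0 ∨ v 1 ≠ 0 ∨ v 2 ≠ 0 := by
    by_contra! h
    exact h0 (funext fun i => by fin_cases i <;> simp [h])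
  cases M
  · have h1 : v 2 = 0 := hv.2 rfl
    simp only [Model.form, Model.curv, h1]
    rcases h with h | h | h
    · linarith [mul_self_pos.2 h, mul_self_nonneg (v 1)]
    · linarith [mul_self_pos.2 h, mul_self_nonneg (v 0)]
    · exact absurd h1 h
  · simp only [Model.form, Model.curv]
    rcases h with h | h | h <;>
      linarith [mul_self_pos.2 h, mul_self_nonneg (v 0), mul_self_nonneg (v 1),
        mul_self_nonneg (v 2)]
  · obtain ⟨⟨hp1, hp2⟩, hv, -⟩ := And.intro hp hv
    simp only [Model.form, Model.curv] at hv ⊢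
    have h3 : p 2 * v 2 = p 0 * v 0 + p 1 * v 1 := by linarith
    -- Cauchy–Schwarz; the strict inequality comes from `p₂² = p₀² + p₁² + 1`.
    have h4 : (p 0 * v 0 + p 1 * v 1) ^ 2 ≤ (p 0 ^ 2 + p 1 ^ 2) * (v 0 ^ 2 + v 1 ^ 2) := by
      nlinarith [sq_nonneg (p 0 * v 1 - p 1 * v 0)]
    rw [← h3] at h4
    have h5 : 0 < v 0 ^ 2 + v 1 ^ 2 := by
      by_contra! h6
      have h7 : v 0 = 0 := by nlinarith [sq_nonneg (v 0), sq_nonneg (v 1)]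
      have h8 : v 1 = 0 := by nlinarith [sq_nonneg (v 0), sq_nonneg (v 1)]
      rw [h7, h8] at h3
      have : v 2 = 0 := by simpa [hp2.ne'] using h3
      simp_all
    have h6 : p 2 ^ 2 * (v 2 ^ 2) < p 2 ^ 2 * (v 0 ^ 2 + v 1 ^ 2) := by nlinarith
    have := lt_of_mul_lt_mul_left h6 (sq_nonneg _)
    linarith

/-! ### Normal form of a conic -/

theorem dot_mulVec_comm {C : Matrix (Fin 3) (Fin 3) ℝ} (hC : C.IsSymm) (x y : Fin 3 → ℝ) :
    C.mulVec x ⬝ᵥ y = C.mulVec y ⬝ᵥ x := by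
  rw [dotProduct_comm, dotProduct_mulVec, ← mulVec_transpose, hC]

/-- A nondegenerate conic through `O` has the equation `y₁² = y₀y₂` in suitable linear coordinates
with `O = (1, 0, 0)`. -/
theorem exists_conic_coords {C : Matrix (Fin 3) (Fin 3) ℝ} (hC : C.IsSymm) (hdet : C.det ≠ 0)
    {O : Fin 3 → ℝ} (hO : O ≠ 0) (hCO : C.mulVec O ⬝ᵥ O = 0) :
    ∃ E : Matrix (Fin 3) (Fin 3) ℝ, E.det ≠ 0 ∧ E.mulVec ![1, 0, 0] = O ∧
      ∃ k : ℝ, k ≠ 0 ∧ ∀ y, C.mulVec (E.mulVec y) ⬝ᵥ E.mulVec y = k * (y 1 ^ 2 - y 0 * y 2) := by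
  have hinj : ∀ x, C.mulVec x = 0 → x = 0 := fun x hx => by
    by_contra h
    exact hdet (exists_mulVec_eq_zero_iff.1 ⟨x, h, hx⟩)
  set B : (Fin 3 → ℝ) → (Fin 3 → ℝ) → ℝ := fun x y => C.mulVec x ⬝ᵥ y with hB
  have hBs : ∀ x y, B x y = B y x := dot_mulVec_comm hC
  have hadd : ∀ x y z, B (x + y) z = B x z + B y z := fun x y z => by
    simp [hB, mulVec_add]
  have hsmul : ∀ (a : ℝ) x z, B (a • x) z = a * B x z := fun a x z => by
    simp [hB, mulVec_smul]
  have hadd' : ∀ x y z, B z (x + y) = B z x + B z y := fun x y z => by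
    rw [hBs, hadd, hBs x, hBs y]
  have hsmul' : ∀ (a : ℝ) x z, B z (a • x) = a * B z x := fun a x z => by
    rw [hBs, hsmul, hBs x]
  have hnd : ∀ x, (∀ y, B x y = 0) → x = 0 := fun x hx =>
    hinj x (dotProduct_eq_zero _ hx)
  have hOO : B O O = 0 := hCO
  obtain ⟨w, hw⟩ : ∃ w, B O w ≠ 0 := by
    by_contra! h
    exact hO (hnd O h)
  -- Complete `O` to a hyperbolic pair: moving `w` along the isotropic vector `O` keeps `B O w` and
  -- can cancel `B w w`.
  obtain ⟨f, hf, hff⟩ : ∃ f, B O f ≠ 0 ∧ B f f = 0 := by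
    refine ⟨w + (-(B w w / (2 * B O w))) • O, ?_, ?_⟩
    · rw [hadd', hsmul', hOO, mul_zero, add_zero]
      exact hw
    · rw [hadd, hsmul, hadd', hadd', hsmul', hsmul', hOO, hBs w O]
      field_simp
      ring
  -- The pole of the line `Of`: it is `B`-orthogonal to both `O` and `f`.
  set e := crossProduct (C.mulVec O) (C.mulVec f) with he
  have hOe : B O e = 0 := dot_self_cross _ _
  have hfe : B f e = 0 := dot_cross_self _ _
  have hdet3 : det3 f O e ≠ 0 := by
    have : det3 f O e = B O f * B O f := by
      rw [det3, he, cross_dot_cross, dotProduct_comm f, dotProduct_comm O, dotProduct_comm O,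
        dotProduct_comm f]
      change B O f * B f O - B f f * B O O = _
      rw [hOO, hBs f O]
      ring
    rw [this]
    exact mul_ne_zero hf hf
  -- Otherwise `C e` would annihilate the basis `O, e, f`.
  have hee : B e e ≠ 0 := by
    intro h
    have h1 : (Matrix.of ![O, e, f]).mulVec (C.mulVec e) = 0 := by
      funext i
      fin_cases i
      · exact (dotProduct_comm _ _).trans ((hBs e O).trans hOe)
      · exact (dotProduct_comm _ _).trans h
      · exact (dotProduct_comm _ _).trans ((hBs e f).trans hfe)
    have h2 : C.mulVec e = 0 := by
      by_contra h3
      have h4 := exists_mulVec_eq_zero_iff.1 ⟨_, h3, h1⟩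
      apply hdet3
      rw [det_fin_three] at h4
      simp at h4
      rw [det3_eq]
      linear_combination h4
    have h5 : e = 0 := hinj e h2
    exact hdet3 (by simp [det3, h5])
  have hE : ∀ y, (Matrix.of ![O, e, (-(B e e / (2 * B O f))) • f])ᵀ.mulVec y
      = y 0 • O + y 1 • e + (y 2 * (-(B e e / (2 * B O f)))) • f := fun y => by
    funext i
    simp [mulVec, dotProduct, Fin.sum_univ_three]
    ring
  -- The factor on `f` makes the `y₀y₂` coefficient equal to `-B e e`.
  refine ⟨(Matrix.of ![O, e, (-(B e e / (2 * B O f))) • f])ᵀ, ?_, ?_, B e e, hee, fun y => ?_⟩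
  · rw [det_transpose]
    have : (Matrix.of ![O, e, (-(B e e / (2 * B O f))) • f]).det
        = (-(B e e / (2 * B O f))) * det3 f O e := by
      rw [det_fin_three, det3_eq]
      simp
      ring
    rw [this]
    refine mul_ne_zero (neg_ne_zero.2 (div_ne_zero hee (mul_ne_zero two_ne_zero hf))) hdet3
  · rw [hE]
    simp
  · rw [hE]
    change B _ _ = _
    simp only [hadd, hsmul, hadd', hsmul', hOO, hOe, hfe, hff, hBs e O, hBs e f, hBs f O]
    field_simp
    ring

/-! ### Parametrization of a conic on the surface -/

/-- The parametrization `t ↦ (1, t, t²)` of the cone `y₁² = y₀y₂`, in the coordinates given by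
`E`. -/
noncomputable def quadCurve (E : Matrix (Fin 3) (Fin 3) ℝ) (t : ℝ) : Fin 3 → ℝ :=
  E.mulVec ![1, t, t ^ 2]

/-- The derivative of `quadCurve`. -/
noncomputable def quadVel (E : Matrix (Fin 3) (Fin 3) ℝ) (t : ℝ) : Fin 3 → ℝ :=
  E.mulVec ![0, 1, 2 * t]

/-- The parametrization of a conic on the surface by central projection. -/
noncomputable def Model.conicCurve (M : Model) (E : Matrix (Fin 3) (Fin 3) ℝ) (t : ℝ) :
    Fin 3 → ℝ :=
  M.proj (quadCurve E t)

/-- The factor of the central projection along `quadCurve`. -/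
noncomputable def Model.conicScale (M : Model) (E : Matrix (Fin 3) (Fin 3) ℝ) (t : ℝ) : ℝ :=
  (√(M.radial (quadCurve E t)))⁻¹

theorem hasDerivAt_quadCurve (E : Matrix (Fin 3) (Fin 3) ℝ) (t : ℝ) :
    HasDerivAt (quadCurve E) (quadVel E t) t := by
  rw [hasDerivAt_pi]
  intro i
  have h : HasDerivAt (fun s : ℝ => E i 0 + E i 1 * s + E i 2 * s ^ 2)
      (E i 1 * 1 + E i 2 * (2 * t)) t := by
    have h1 := ((hasDerivAt_id t).const_mul (E i 1)).const_add (E i 0)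
    have h2 := ((hasDerivAt_pow 2 t).const_mul (E i 2))
    exact (h1.add h2).congr_deriv (by simp)
  have h' : (fun s => quadCurve E s i) = fun s : ℝ => E i 0 + E i 1 * s + E i 2 * s ^ 2 := by
    funext s
    simp [quadCurve, mulVec, dotProduct, Fin.sum_univ_three]
  rw [h']
  refine h.congr_deriv ?_
  simp [quadVel, mulVec, dotProduct, Fin.sum_univ_three]

theorem hasDerivAt_quadVel (E : Matrix (Fin 3) (Fin 3) ℝ) (t : ℝ) :
    HasDerivAt (quadVel E) (E.mulVec ![0, 0, 2]) t := by
  rw [hasDerivAt_pi]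
  intro i
  have h : HasDerivAt (fun s : ℝ => E i 1 + E i 2 * (2 * s)) (E i 2 * (2 * 1)) t :=
    (((hasDerivAt_id t).const_mul 2).const_mul (E i 2)).const_add (E i 1)
  have h' : (fun s => quadVel E s i) = fun s : ℝ => E i 1 + E i 2 * (2 * s) := by
    funext s
    simp [quadVel, mulVec, dotProduct, Fin.sum_univ_three]
  rw [h']
  refine h.congr_deriv ?_
  simp [mulVec, dotProduct, Fin.sum_univ_three]

theorem contDiff_quadCurve (E : Matrix (Fin 3) (Fin 3) ℝ) : ContDiff ℝ 2 (quadCurve E) := by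
  rw [contDiff_pi]
  intro i
  have : (fun t => quadCurve E t i) = fun s : ℝ => E i 0 + E i 1 * s + E i 2 * s ^ 2 := by
    funext s
    simp [quadCurve, mulVec, dotProduct, Fin.sum_univ_three]
  rw [this]
  fun_prop

theorem Model.contDiffAt_conicScale {M : Model} {E : Matrix (Fin 3) (Fin 3) ℝ} {t : ℝ}
    (h : quadCurve E t ∈ M.cone) : ContDiffAt ℝ 2 (M.conicScale E) t := by
  have h1 := M.radial_pos h
  have h2 : ContDiffAt ℝ 2 (fun t => M.radial (quadCurve E t)) t :=
    (M.contDiff_radial.comp (contDiff_quadCurve E)).contDiffAt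
  exact (h2.sqrt h1.ne').inv (Real.sqrt_pos.2 h1).ne'

theorem Model.conicScale_pos {M : Model} {E : Matrix (Fin 3) (Fin 3) ℝ} {t : ℝ}
    (h : quadCurve E t ∈ M.cone) : 0 < M.conicScale E t :=
  inv_pos.2 (Real.sqrt_pos.2 (M.radial_pos h))

theorem Model.conicCurve_eq (M : Model) (E : Matrix (Fin 3) (Fin 3) ℝ) (t : ℝ) :
    M.conicCurve E t = M.conicScale E t • quadCurve E t := rfl

theorem Model.contDiffAt_conicCurve {M : Model} {E : Matrix (Fin 3) (Fin 3) ℝ} {t : ℝ}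
    (h : quadCurve E t ∈ M.cone) : ContDiffAt ℝ 2 (M.conicCurve E) t :=
  (M.contDiffAt_conicScale h).smul (contDiff_quadCurve E).contDiffAt

theorem Model.hasDerivAt_conicCurve {M : Model} {E : Matrix (Fin 3) (Fin 3) ℝ} {t : ℝ}
    (h : quadCurve E t ∈ M.cone) :
    HasDerivAt (M.conicCurve E)
      (M.conicScale E t • quadVel E t + deriv (M.conicScale E) t • quadCurve E t) t :=
  ((M.contDiffAt_conicScale h).differentiableAt (by norm_num)).hasDerivAt.smul
    (hasDerivAt_quadCurve E t)

/-- One box in affine coordinates serves the curve points, the vertices of the tangent triangle and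
the concurrency point. Having `δ < 1` keeps squares and products of parameters inside it. -/
theorem exists_forall_mem_cone {M : Model} {E : Matrix (Fin 3) (Fin 3) ℝ}
    (hO : E.mulVec ![1, 0, 0] ∈ M.cone) :
    ∃ δ : ℝ, 0 < δ ∧ δ < 1 ∧ ∀ p q : ℝ, |p| < δ → |q| < δ → E.mulVec ![1, p, q] ∈ M.cone := by
  have hc : Continuous (fun p : ℝ × ℝ => E.mulVec ![1, p.1, p.2]) := by
    refine Continuous.matrix_mulVec continuous_const ?_
    rw [continuous_pi_iff]
    intro i
    fin_cases i
    · exact continuous_const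
    · exact continuous_fst
    · exact continuous_snd
  have h1 : ∀ᶠ p in 𝓝 ((0 : ℝ), (0 : ℝ)), E.mulVec ![1, p.1, p.2] ∈ M.cone :=
    hc.continuousAt.eventually (M.isOpen_cone.mem_nhds hO)
  obtain ⟨ε, hε, h2⟩ := Metric.eventually_nhds_iff.1 h1
  refine ⟨min ε (1 / 2), by positivity, (min_le_right _ _).trans_lt (by norm_num), ?_⟩
  intro p q hp hq
  refine h2 (y := (p, q)) ?_
  rw [Prod.dist_eq, max_lt_iff]
  simp only [Real.dist_eq, sub_zero]
  exact ⟨hp.trans_le (min_le_left _ _), hq.trans_le (min_le_left _ _)⟩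

theorem quadCurve_mem_cone {M : Model} {E : Matrix (Fin 3) (Fin 3) ℝ} {δ : ℝ} (hδ1 : δ < 1)
    (hδ : ∀ p q : ℝ, |p| < δ → |q| < δ → E.mulVec ![1, p, q] ∈ M.cone) {t : ℝ} (ht : |t| < δ) :
    quadCurve E t ∈ M.cone := by
  refine hδ _ _ ht ?_
  rw [abs_pow]
  nlinarith [abs_nonneg t]

theorem Model.conicCurve_mem_conic {M : Model} {C E : Matrix (Fin 3) (Fin 3) ℝ} {k : ℝ}
    (hk : ∀ y, C.mulVec (E.mulVec y) ⬝ᵥ E.mulVec y = k * (y 1 ^ 2 - y 0 * y 2)) {t : ℝ}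
    (h : quadCurve E t ∈ M.cone) : M.conicCurve E t ∈ M.conic C := by
  refine ⟨M.proj_mem h, ?_⟩
  have := hk ![1, t, t ^ 2]
  rw [conicCurve_eq, mulVec_smul, smul_dotProduct, dotProduct_smul, quadCurve, this]
  simp

/-- The parameter on the conic of a point of it. -/
noncomputable def conicParam (E : Matrix (Fin 3) (Fin 3) ℝ) (x : Fin 3 → ℝ) : ℝ :=
  (E⁻¹.mulVec x) 1 / (E⁻¹.mulVec x) 0

theorem inv_mulVec_mulVec {E : Matrix (Fin 3) (Fin 3) ℝ} (hE : E.det ≠ 0) (y : Fin 3 → ℝ) :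
    E⁻¹.mulVec (E.mulVec y) = y := by
  rw [mulVec_mulVec, nonsing_inv_mul _ (isUnit_iff_ne_zero.2 hE), one_mulVec]

theorem mulVec_inv_mulVec {E : Matrix (Fin 3) (Fin 3) ℝ} (hE : E.det ≠ 0) (y : Fin 3 → ℝ) :
    E.mulVec (E⁻¹.mulVec y) = y := by
  rw [mulVec_mulVec, mul_nonsing_inv _ (isUnit_iff_ne_zero.2 hE), one_mulVec]

theorem continuous_inv_mulVec_apply (E : Matrix (Fin 3) (Fin 3) ℝ) (i : Fin 3) :
    Continuous (fun x => E⁻¹.mulVec x i) :=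
  (continuous_apply i).comp (Continuous.matrix_mulVec continuous_const continuous_id)

/-- Near `O` the coordinate `y₀` is positive, so `y₁² = y₀y₂` makes `y` a positive multiple of `(1,
t, t²)` with `t = y₁/y₀`, and projection ignores positive factors. -/
theorem eventually_eq_conicCurve {M : Model} {C E : Matrix (Fin 3) (Fin 3) ℝ} {k : ℝ}
    (hE : E.det ≠ 0) (hk0 : k ≠ 0)
    (hk : ∀ y, C.mulVec (E.mulVec y) ⬝ᵥ E.mulVec y = k * (y 1 ^ 2 - y 0 * y 2)) :
    ∀ᶠ x in 𝓝 (E.mulVec ![1, 0, 0]), x ∈ M.conic C → x = M.conicCurve E (conicParam E x) := by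
  have h0 : E⁻¹.mulVec (E.mulVec ![1, 0, 0]) 0 = 1 := by
    rw [inv_mulVec_mulVec hE]
    rfl
  have h1 : ∀ᶠ x in 𝓝 (E.mulVec ![1, 0, 0]), 0 < E⁻¹.mulVec x 0 :=
    (continuous_inv_mulVec_apply E 0).continuousAt.eventually
      (lt_mem_nhds (by change 0 < E⁻¹.mulVec _ 0; rw [h0]; exact one_pos))
  filter_upwards [h1] with x hx hxC
  have h2 := hk (E⁻¹.mulVec x)
  rw [mulVec_inv_mulVec hE, hxC.2, eq_comm, mul_eq_zero] at h2
  have h3 := h2.resolve_left hk0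
  have h4 : x = (E⁻¹.mulVec x 0) • quadCurve E (conicParam E x) := by
    conv_lhs => rw [← mulVec_inv_mulVec hE x]
    rw [quadCurve, ← mulVec_smul, conicParam]
    congr 1
    funext i
    fin_cases i
    · simp
    · simp
      field_simp
    · simp
      field_simp
      linarith
  rw [Model.conicCurve, ← M.proj_smul hx, ← h4, M.proj_eq_self hxC.1]

theorem conicParam_base {E : Matrix (Fin 3) (Fin 3) ℝ} (hE : E.det ≠ 0) :
    conicParam E (E.mulVec ![1, 0, 0]) = 0 := by
  rw [conicParam, inv_mulVec_mulVec hE]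
  simp

theorem continuousAt_conicParam {E : Matrix (Fin 3) (Fin 3) ℝ} (hE : E.det ≠ 0) :
    ContinuousAt (conicParam E) (E.mulVec ![1, 0, 0]) := by
  refine (continuous_inv_mulVec_apply E 1).continuousAt.div
    (continuous_inv_mulVec_apply E 0).continuousAt ?_
  rw [inv_mulVec_mulVec hE]
  simp

/-! ### Tangent incidence on a conic -/

theorem Model.geodesic_smul_smul (M : Model) {k l : ℝ} (hk : k ≠ 0) (hl : l ≠ 0)
    (a b : Fin 3 → ℝ) : M.geodesic (k • a) (l • b) = M.geodesic a b := by
  ext Y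
  simp only [Model.geodesic, Set.mem_ofPred_eq, Submodule.mem_span_pair, smul_smul]
  refine and_congr_right fun _ => ⟨?_, ?_⟩
  · rintro ⟨α, β, h⟩
    exact ⟨_, _, h⟩
  · rintro ⟨α, β, h⟩
    exact ⟨α / k, β / l, by rwa [div_mul_cancel₀ _ hk, div_mul_cancel₀ _ hl]⟩

theorem Model.proj_ne {M : Model} {x : Fin 3 → ℝ} (h : x ∈ M.cone) : (√(M.radial x))⁻¹ ≠ 0 :=
  inv_ne_zero (Real.sqrt_pos.2 (M.radial_pos h)).ne'

/-- The equation of the tangent plane at parameter `s` to the cone `y₁² = y₀y₂`. -/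
def tangentForm (s : ℝ) (y : Fin 3 → ℝ) : ℝ := s ^ 2 * y 0 - 2 * s * y 1 + y 2

/-- Projection only rescales the curve, so position and velocity span the same plane as `(1, s, s²)`
and `(0, 1, 2s)`. -/
theorem Model.mem_tangent_geodesic {M : Model} {E : Matrix (Fin 3) (Fin 3) ℝ} (hE : E.det ≠ 0)
    {s : ℝ} (h : quadCurve E s ∈ M.cone) (Y : Fin 3 → ℝ) :
    Y ∈ M.geodesic (M.conicCurve E s) (deriv (M.conicCurve E) s) ↔
      Y ∈ M.surface ∧ tangentForm s (E⁻¹.mulVec Y) = 0 := by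
  rw [(M.hasDerivAt_conicCurve h).deriv, conicCurve_eq]
  have h0 := (M.conicScale_pos h).ne'
  simp only [Model.geodesic, Set.mem_ofPred_eq, Submodule.mem_span_pair]
  refine and_congr_right fun _ => ⟨?_, fun hy => ?_⟩
  · rintro ⟨α, β, rfl⟩
    simp only [mulVec_add, mulVec_smul, quadCurve, quadVel, inv_mulVec_mulVec hE, tangentForm]
    simp
    ring
  · set y := E⁻¹.mulVec Y with hy'
    have h1 : Y = y 0 • quadCurve E s + (y 1 - s * y 0) • quadVel E s := by
      rw [← mulVec_inv_mulVec hE Y, ← hy', quadCurve, quadVel, ← mulVec_smul, ← mulVec_smul,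
        ← mulVec_add]
      congr 1
      rw [tangentForm] at hy
      funext i
      fin_cases i
      · simp
      · simp
        ring
      · simp
        linarith
    refine ⟨(y 0 - (y 1 - s * y 0) / M.conicScale E s * deriv (M.conicScale E) s)
      / M.conicScale E s, (y 1 - s * y 0) / M.conicScale E s, ?_⟩
    conv_rhs => rw [h1]
    rw [smul_smul, smul_add, smul_smul, smul_smul, div_mul_cancel₀ _ h0, div_mul_cancel₀ _ h0]
    module

/-- The intersection point of the tangent planes at parameters `t` and `u`. -/
noncomputable def polarPoint (E : Matrix (Fin 3) (Fin 3) ℝ) (t u : ℝ) : Fin 3 → ℝ :=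
  E.mulVec ![1, (t + u) / 2, t * u]

theorem Model.isOnePoint_tangents {M : Model} {E : Matrix (Fin 3) (Fin 3) ℝ} (hE : E.det ≠ 0)
    {t u : ℝ} (ht : quadCurve E t ∈ M.cone) (hu : quadCurve E u ∈ M.cone)
    (h : polarPoint E t u ∈ M.cone) (htu : t ≠ u) :
    M.IsOnePoint (M.geodesic (M.conicCurve E t) (deriv (M.conicCurve E) t) ∩
      M.geodesic (M.conicCurve E u) (deriv (M.conicCurve E) u)) (M.proj (polarPoint E t u)) := by
  refine isOnePoint_of_forall (M.proj_mem h) fun Y => ?_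
  rw [Set.mem_inter_iff, M.mem_tangent_geodesic hE ht, M.mem_tangent_geodesic hE hu,
    ← and_and_left]
  refine and_congr_right fun _ => ⟨?_, ?_⟩
  · rintro ⟨h1, h2⟩
    set y := E⁻¹.mulVec Y with hy'
    have h0 := M.proj_ne h
    refine ⟨y 0 / (√(M.radial (polarPoint E t u)))⁻¹, ?_⟩
    rw [Model.proj, smul_smul, div_mul_cancel₀ _ h0, polarPoint, ← mulVec_smul,
      ← mulVec_inv_mulVec hE Y, ← hy']
    congr 1
    rw [tangentForm] at h1 h2
    have h3 : y 1 = (t + u) / 2 * y 0 := by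
      apply mul_left_cancel₀ (sub_ne_zero.2 htu)
      linarith
    funext i
    fin_cases i
    · simp
    · simp
      linarith
    · simp
      rw [h3] at h1
      linarith
  · rintro ⟨k, rfl⟩
    simp only [Model.proj, mulVec_smul, polarPoint, inv_mulVec_mulVec hE, tangentForm]
    simp
    constructor <;> ring

/-- Homogeneous coordinates of the intersection point of the three lines joining the points of a
conic with parameters `s`, `t`, `u` to the opposite vertices of the tangent triangle. -/
def gergonneCoords (s t u : ℝ) : Fin 3 → ℝ :=
  ![(t - u) ^ 2 + (u - s) ^ 2 + (s - t) ^ 2,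
    (t - u) ^ 2 * s + (u - s) ^ 2 * t + (s - t) ^ 2 * u,
    (t - u) ^ 2 * s ^ 2 + (u - s) ^ 2 * t ^ 2 + (s - t) ^ 2 * u ^ 2]

theorem gergonneCoords_rotate (s t u : ℝ) : gergonneCoords t u s = gergonneCoords s t u := by
  simp only [gergonneCoords]
  congr 1
  · ring
  · congr 1
    · ring
    · congr 1
      ring

theorem exists_gergonneCoords_eq (E : Matrix (Fin 3) (Fin 3) ℝ) (s t u : ℝ) :
    E.mulVec (gergonneCoords s t u) = (2 * ((s - t) * (s - u))) • polarPoint E t u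
      + (2 * (t - u) ^ 2) • quadCurve E s := by
  rw [polarPoint, quadCurve, ← mulVec_smul, ← mulVec_smul, ← mulVec_add]
  congr 1
  simp only [gergonneCoords]
  funext i
  fin_cases i <;> simp <;> ring

/-- Both forms vanish at the polar point, so their ratio is constant on the line; at `(1, s, s²)`
they equal `(t-s)²` and `(u-s)²`. -/
theorem tangentForm_rel {M : Model} {E : Matrix (Fin 3) (Fin 3) ℝ} (hE : E.det ≠ 0)
    {s t u : ℝ} {Y : Fin 3 → ℝ} (hY : Y ∈ M.geodesic (polarPoint E t u) (quadCurve E s)) :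
    tangentForm t (E⁻¹.mulVec Y) * (u - s) ^ 2 = tangentForm u (E⁻¹.mulVec Y) * (t - s) ^ 2 := by
  obtain ⟨α, β, rfl⟩ := Submodule.mem_span_pair.1 hY.2
  simp only [mulVec_add, mulVec_smul, quadCurve, polarPoint, inv_mulVec_mulVec hE, tangentForm]
  simp
  ring

/-- The two relations fix the ratios of the three tangent forms, which are independent linear
coordinates. They are inverted below by Vandermonde cofactors. -/
theorem eq_smul_gergonneCoords {s t u : ℝ} (hst : s ≠ t) (htu : t ≠ u) (hus : u ≠ s)
    {y : Fin 3 → ℝ} (h1 : tangentForm t y * (u - s) ^ 2 = tangentForm u y * (t - s) ^ 2)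
    (h2 : tangentForm u y * (s - t) ^ 2 = tangentForm s y * (u - t) ^ 2) :
    ∃ k : ℝ, y = k • gergonneCoords s t u := by
  have e1 := sub_ne_zero.2 hst
  have e2 := sub_ne_zero.2 htu
  have e3 := sub_ne_zero.2 hus
  -- The denominator is the value of `tangentForm s` at `gergonneCoords s t u`.
  refine ⟨tangentForm s y / (2 * ((s - t) ^ 2 * (u - s) ^ 2)), ?_⟩
  set k := tangentForm s y / (2 * ((s - t) ^ 2 * (u - s) ^ 2)) with hk
  have hs : tangentForm s y = 2 * k * ((s - t) ^ 2 * (u - s) ^ 2) := by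
    rw [hk]; field_simp
  have hu : tangentForm u y = 2 * k * ((u - t) ^ 2 * (u - s) ^ 2) := by
    apply mul_right_cancel₀ (pow_ne_zero 2 e1)
    rw [h2, hs]; ring
  have ht : tangentForm t y = 2 * k * ((t - u) ^ 2 * (t - s) ^ 2) := by
    apply mul_right_cancel₀ (pow_ne_zero 2 e3)
    rw [h1, hu]; ring
  rw [tangentForm] at hs ht hu
  have hV := mul_ne_zero (mul_ne_zero e1 e2) e3
  have hz0 : y 0 = k * ((t - u) ^ 2 + (u - s) ^ 2 + (s - t) ^ 2) := by
    apply mul_left_cancel₀ hV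
    linear_combination -(t - u) * hs - (u - s) * ht - (s - t) * hu
  have hz1 : y 1 = k * ((t - u) ^ 2 * s + (u - s) ^ 2 * t + (s - t) ^ 2 * u) := by
    apply mul_left_cancel₀ hV
    linear_combination -(t ^ 2 - u ^ 2) / 2 * hs - (u ^ 2 - s ^ 2) / 2 * ht
      - (s ^ 2 - t ^ 2) / 2 * hu
  have hz2 : y 2 = k * ((t - u) ^ 2 * s ^ 2 + (u - s) ^ 2 * t ^ 2 + (s - t) ^ 2 * u ^ 2) := by
    apply mul_left_cancel₀ hV
    linear_combination -(t - u) * t * u * hs - (u - s) * u * s * ht - (s - t) * s * t * hu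
  funext i
  fin_cases i
  · exact hz0
  · exact hz1
  · exact hz2

theorem Model.isOnePoint_gergonne {M : Model} {E : Matrix (Fin 3) (Fin 3) ℝ} (hE : E.det ≠ 0)
    {δ : ℝ} (hδ1 : δ < 1)
    (hδ : ∀ p q : ℝ, |p| < δ → |q| < δ → E.mulVec ![1, p, q] ∈ M.cone) {s t u : ℝ}
    (hs : |s| < δ) (ht : |t| < δ) (hu : |u| < δ) (hst : s ≠ t) (htu : t ≠ u) (hus : u ≠ s) :
    M.IsOnePoint (M.geodesic (polarPoint E t u) (quadCurve E s) ∩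
      M.geodesic (polarPoint E u s) (quadCurve E t) ∩
      M.geodesic (polarPoint E s t) (quadCurve E u))
      (M.proj (E.mulVec (gergonneCoords s t u))) := by
  have e1 := sq_pos_of_ne_zero (sub_ne_zero.2 hst)
  have e2 := sq_pos_of_ne_zero (sub_ne_zero.2 htu)
  have e3 := sq_pos_of_ne_zero (sub_ne_zero.2 hus)
  have hW : 0 < (t - u) ^ 2 + (u - s) ^ 2 + (s - t) ^ 2 := by positivity
  have hsq : ∀ x : ℝ, |x| < δ → x ^ 2 < δ ∧ -δ < x ^ 2 := fun x hx => by
    have := abs_nonneg x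
    constructor <;> nlinarith [sq_abs x]
  -- The Gergonne point is a weighted mean of curve points, so it stays in the box.
  have hmean : ∀ a b c : ℝ, (a < δ ∧ -δ < a) → (b < δ ∧ -δ < b) → (c < δ ∧ -δ < c) →
      |((t - u) ^ 2 * a + (u - s) ^ 2 * b + (s - t) ^ 2 * c)
        / ((t - u) ^ 2 + (u - s) ^ 2 + (s - t) ^ 2)| < δ := by
    intro a b c ha hb hc
    rw [abs_lt, lt_div_iff₀ hW, div_lt_iff₀ hW]
    constructor
    · linarith [mul_lt_mul_of_pos_left ha.2 e2, mul_lt_mul_of_pos_left hb.2 e3,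
        mul_lt_mul_of_pos_left hc.2 e1]
    · linarith [mul_lt_mul_of_pos_left ha.1 e2, mul_lt_mul_of_pos_left hb.1 e3,
        mul_lt_mul_of_pos_left hc.1 e1]
  have hcone : E.mulVec (gergonneCoords s t u) ∈ M.cone := by
    have h1 := M.smul_mem_cone hW (hδ _ _
      (hmean s t u ((abs_lt.1 hs).symm) ((abs_lt.1 ht).symm) ((abs_lt.1 hu).symm))
      (hmean _ _ _ (hsq s hs) (hsq t ht) (hsq u hu)))
    rw [← mulVec_smul] at h1
    convert h1 using 2
    funext i
    fin_cases i
    · simp [gergonneCoords]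
    · simp [gergonneCoords, mul_div_cancel₀ _ hW.ne']
    · simp [gergonneCoords, mul_div_cancel₀ _ hW.ne']
  refine isOnePoint_of_forall (M.proj_mem hcone) fun Y => ⟨?_, ?_⟩
  · rintro ⟨⟨h1, h2⟩, -⟩
    obtain ⟨k, hk⟩ := eq_smul_gergonneCoords hst htu hus (tangentForm_rel hE h1)
      (tangentForm_rel hE h2)
    refine ⟨h1.1, k / (√(M.radial (E.mulVec (gergonneCoords s t u))))⁻¹, ?_⟩
    rw [Model.proj, smul_smul, div_mul_cancel₀ _ (M.proj_ne hcone), ← mulVec_smul, ← hk,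
      mulVec_inv_mulVec hE]
  · rintro ⟨hY, k, rfl⟩
    refine ⟨⟨⟨hY, ?_⟩, hY, ?_⟩, hY, ?_⟩
    · refine Submodule.smul_mem _ _ (Submodule.smul_mem _ _ ?_)
      rw [exists_gergonneCoords_eq]
      exact Submodule.mem_span_pair.2 ⟨_, _, rfl⟩
    · refine Submodule.smul_mem _ _ (Submodule.smul_mem _ _ ?_)
      rw [← gergonneCoords_rotate, exists_gergonneCoords_eq]
      exact Submodule.mem_span_pair.2 ⟨_, _, rfl⟩
    · refine Submodule.smul_mem _ _ (Submodule.smul_mem _ _ ?_)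
      rw [← gergonneCoords_rotate, ← gergonneCoords_rotate, exists_gergonneCoords_eq]
      exact Submodule.mem_span_pair.2 ⟨_, _, rfl⟩

theorem Model.tangentIncidenceAt_conicCurve {M : Model} {E : Matrix (Fin 3) (Fin 3) ℝ}
    (hE : E.det ≠ 0) {δ : ℝ} (hδ1 : δ < 1)
    (hδ : ∀ p q : ℝ, |p| < δ → |q| < δ → E.mulVec ![1, p, q] ∈ M.cone) {s t u : ℝ}
    (hs : |s| < δ) (ht : |t| < δ) (hu : |u| < δ) (hst : s ≠ t) (htu : t ≠ u) (hus : u ≠ s) :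
    M.TangentIncidenceAt (M.conicCurve E) s t u := by
  have hq : ∀ a : ℝ, |a| < δ → quadCurve E a ∈ M.cone := fun a => quadCurve_mem_cone hδ1 hδ
  have hp : ∀ a b : ℝ, |a| < δ → |b| < δ → polarPoint E a b ∈ M.cone := fun a b ha hb => by
    refine hδ _ _ ?_ ?_
    · rw [abs_lt] at ha hb ⊢
      constructor <;> linarith
    · rw [abs_mul]
      nlinarith [abs_nonneg a, abs_nonneg b]
  refine ⟨_, _, _, _, M.isOnePoint_tangents hE (hq t ht) (hq u hu) (hp t u ht hu) htu,
    M.isOnePoint_tangents hE (hq u hu) (hq s hs) (hp u s hu hs) hus,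
    M.isOnePoint_tangents hE (hq s hs) (hq t ht) (hp s t hs ht) hst,
    (?_ : M.IsOnePoint _ (M.proj (E.mulVec (gergonneCoords s t u))))⟩
  rw [Model.proj, Model.proj, Model.proj, Model.conicCurve_eq, Model.conicCurve_eq,
    Model.conicCurve_eq,
    M.geodesic_smul_smul (M.proj_ne (hp t u ht hu)) (M.conicScale_pos (hq s hs)).ne',
    M.geodesic_smul_smul (M.proj_ne (hp u s hu hs)) (M.conicScale_pos (hq t ht)).ne',
    M.geodesic_smul_smul (M.proj_ne (hp s t hs ht)) (M.conicScale_pos (hq u hu)).ne']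
  exact M.isOnePoint_gergonne hE hδ1 hδ hs ht hu hst htu hus

/-! ### Nonvanishing curvature of a `C²` curve -/

theorem contDiffAt_one_deriv {c : ℝ → Fin 3 → ℝ} {t : ℝ} (h : ContDiffAt ℝ 2 c t) :
    ContDiffAt ℝ 1 (deriv c) t := by
  exact h.derivWithin (by norm_num)

theorem hasDerivAt_deriv {c : ℝ → Fin 3 → ℝ} {t : ℝ} (h : ContDiffAt ℝ 2 c t) :
    HasDerivAt c (deriv c t) t ∧ HasDerivAt (deriv c) (deriv (deriv c) t) t :=
  ⟨(h.differentiableAt (by norm_num)).hasDerivAt,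
    ((contDiffAt_one_deriv h).differentiableAt (by norm_num)).hasDerivAt⟩

theorem continuousAt_deriv_deriv {c : ℝ → Fin 3 → ℝ} {t : ℝ} (h : ContDiffAt ℝ 2 c t) :
    ContinuousAt (deriv (deriv c)) t :=
  ((contDiffAt_one_deriv h).continuousAt_fderiv (by norm_num)).clm_apply continuousAt_const

theorem eventually_contDiffAt {c : ℝ → Fin 3 → ℝ} {t : ℝ} (h : ContDiffAt ℝ 2 c t) :
    ∀ᶠ s in 𝓝 t, ContDiffAt ℝ 2 c s :=
  h.eventually (by simp)

theorem Model.form_velocity {M : Model} {c : ℝ → Fin 3 → ℝ} {t : ℝ} {v : Fin 3 → ℝ}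
    (hc : HasDerivAt c v t) (h : ∀ᶠ s in 𝓝 t, c s ∈ M.surface) :
    M.curv * M.form (c t) v = 0 ∧ (M = .euclidean → v 2 = 0) := by
  have hi (i : Fin 3) : HasDerivAt (fun s => c s i) (v i) t := hasDerivAt_pi.1 hc i
  have hconst {f : ℝ → ℝ} {a b : ℝ} (hf : HasDerivAt f a t) (hfb : ∀ᶠ s in 𝓝 t, f s = b) :
      a = 0 := by
    have h1 : f =ᶠ[𝓝 t] fun _ => b := hfb
    exact hf.unique ((hasDerivAt_const t b).congr_of_eventuallyEq h1)
  have hq (i : Fin 3) : HasDerivAt (fun s => c s i ^ 2) (2 * c t i * v i) t :=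
    ((hi i).pow 2).congr_deriv (by simp)
  cases M
  · exact ⟨by simp [Model.curv], fun _ => hconst (hi 2) h⟩
  · refine ⟨?_, nofun⟩
    have := hconst (((hq 0).add (hq 1)).add (hq 2)) h
    simp only [Model.curv, Model.form]
    linarith
  · refine ⟨?_, nofun⟩
    have := hconst (((hq 0).add (hq 1)).sub (hq 2)) (h.mono fun s hs => hs.1)
    simp only [Model.curv, Model.form]
    linarith

/-- The numerator is the absolute value of this determinant, and the denominator is positive since
tangent vectors are spacelike. This makes the curvature condition projective. -/
theorem Model.geodesicCurvature_ne_zero_iff {M : Model} {c : ℝ → Fin 3 → ℝ} {t : ℝ}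
    (hc : ContDiffAt ℝ 2 c t) (h : ∀ᶠ s in 𝓝 t, c s ∈ M.surface) (h0 : deriv c t ≠ 0) :
    M.geodesicCurvature c t ≠ 0 ↔ det3 (c t) (deriv c t) (deriv (deriv c) t) ≠ 0 := by
  have h1 := Model.form_velocity (hasDerivAt_deriv hc).1 h
  have hv : M = .euclidean → deriv (deriv c) t 2 = 0 := by
    rintro rfl
    have h2 : ∀ᶠ s in 𝓝 t, deriv c s 2 = 0 := by
      filter_upwards [h.eventually_nhds, eventually_contDiffAt hc] with s hs hs'
      exact (Model.form_velocity (hasDerivAt_deriv hs').1 hs).2 rfl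
    have h3 := hasDerivAt_pi.1 (hasDerivAt_deriv hc).2 2
    have h4 : (fun s => deriv c s 2) =ᶠ[𝓝 t] fun _ => 0 := h2
    exact h3.unique ((hasDerivAt_const t 0).congr_of_eventuallyEq h4)
  have h2 := M.gram_eq_det3_sq h.self_of_nhds h1 hv
  rw [Model.geodesicCurvature, Model.covAccel, h2, Real.sqrt_sq_eq_abs]
  have h3 := Real.sqrt_pos.2 (M.form_self_pos h.self_of_nhds h1 h0)
  rw [div_ne_zero_iff, abs_ne_zero]
  exact and_iff_left (pow_pos h3 3).ne'

/-- Rescaling a curve by `ν` multiplies the determinant of position, velocity and acceleration by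
`ν³`, the derivatives of `ν` cancelling by column operations. For `(1, t, t²)` it is `2 * E.det`. -/
theorem Model.det3_conicCurve_ne_zero {M : Model} {E : Matrix (Fin 3) (Fin 3) ℝ} (hE : E.det ≠ 0)
    {t : ℝ} (h : quadCurve E t ∈ M.cone) :
    det3 (M.conicCurve E t) (deriv (M.conicCurve E) t) (deriv (deriv (M.conicCurve E)) t) ≠ 0 := by
  set ν := M.conicScale E with hν
  have hcone : ∀ᶠ s in 𝓝 t, quadCurve E s ∈ M.cone :=
    (contDiff_quadCurve E).continuous.continuousAt.eventually (M.isOpen_cone.mem_nhds h)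
  have h1 : deriv (M.conicCurve E) =ᶠ[𝓝 t]
      fun s => ν s • quadVel E s + deriv ν s • quadCurve E s := by
    filter_upwards [hcone] with s hs
    exact (M.hasDerivAt_conicCurve hs).deriv
  have hν2 : ContDiffAt ℝ 2 ν t := M.contDiffAt_conicScale h
  have hν' : HasDerivAt ν (deriv ν t) t := (hν2.differentiableAt (by norm_num)).hasDerivAt
  have hν'' : HasDerivAt (deriv ν) (deriv (deriv ν) t) t := by
    have h2 : ContDiffAt ℝ 1 (deriv ν) t := hν2.derivWithin (by norm_num)
    exact (h2.differentiableAt (by norm_num)).hasDerivAt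
  have h2 := (hν'.smul (hasDerivAt_quadVel E t)).add (hν''.smul (hasDerivAt_quadCurve E t))
  rw [h1.deriv_eq.trans h2.deriv, h1.self_of_nhds, conicCurve_eq, ← hν]
  have h3 : det3 (quadCurve E t) (quadVel E t) (E.mulVec ![0, 0, 2]) = 2 * E.det := by
    rw [quadCurve, quadVel, det3_mulVec, det3_eq]
    simp
    ring
  have h4 : det3 (ν t • quadCurve E t) (ν t • quadVel E t + deriv ν t • quadCurve E t)
      (ν t • E.mulVec ![0, 0, 2] + deriv ν t • quadVel E t +
        (deriv ν t • quadVel E t + deriv (deriv ν) t • quadCurve E t))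
      = ν t ^ 3 * det3 (quadCurve E t) (quadVel E t) (E.mulVec ![0, 0, 2]) := by
    simp only [det3_eq, Pi.add_apply, Pi.smul_apply, smul_eq_mul]
    ring
  rw [h4, h3]
  exact mul_ne_zero (pow_ne_zero 3 (M.conicScale_pos h).ne') (mul_ne_zero two_ne_zero hE)

/-! ### Conics have the incidence property -/

theorem Model.exists_conicCurve {M : Model} {C : Matrix (Fin 3) (Fin 3) ℝ} (hC : C.IsSymm)
    (hdet : C.det ≠ 0) {O : Fin 3 → ℝ} (hO : O ∈ M.conic C) :
    ∃ E : Matrix (Fin 3) (Fin 3) ℝ, E.det ≠ 0 ∧ E.mulVec ![1, 0, 0] = O ∧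
      quadCurve E 0 = O ∧ M.conicCurve E 0 = O ∧
      (∀ t, quadCurve E t ∈ M.cone → M.conicCurve E t ∈ M.conic C) ∧
      ∀ᶠ x in 𝓝 O, x ∈ M.conic C → x = M.conicCurve E (conicParam E x) := by
  obtain ⟨E, hE, hEO, k, hk0, hk⟩ := exists_conic_coords hC hdet
    (M.ne_zero_of_mem_surface hO.1) hO.2
  have h0 : quadCurve E 0 = O := by
    rw [← hEO, quadCurve]
    congr 3
    simp
  refine ⟨E, hE, hEO, h0, ?_, fun t ht => M.conicCurve_mem_conic hk ht, ?_⟩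
  · rw [conicCurve, h0, M.proj_eq_self hO.1]
  · rw [← hEO]
    exact eventually_eq_conicCurve hE hk0 hk

theorem Model.hasTangentIncidence_conic {M : Model} {C : Matrix (Fin 3) (Fin 3) ℝ} (hC : C.IsSymm)
    (hdet : C.det ≠ 0) {O : Fin 3 → ℝ} (hO : O ∈ M.conic C) :
    M.HasTangentIncidence (M.conic C) O := by
  obtain ⟨E, hE, hEO, h0, hc0, hmem, hloc⟩ := M.exists_conicCurve hC hdet hO
  obtain ⟨δ, hδ0, hδ1, hδ⟩ := exists_forall_mem_cone (M := M) (E := E)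
    (hEO ▸ M.mem_cone hO.1)
  have hcone : quadCurve E 0 ∈ M.cone := h0 ▸ M.mem_cone hO.1
  have hcone' : ∀ t ∈ Set.Ioo (-δ) δ, quadCurve E t ∈ M.cone := fun t ht =>
    quadCurve_mem_cone hδ1 hδ (abs_lt.2 ht)
  have hsurf : ∀ᶠ t in 𝓝 (0 : ℝ), M.conicCurve E t ∈ M.surface := by
    filter_upwards [Ioo_mem_nhds (neg_lt_zero.2 hδ0) hδ0] with t ht
    exact (hmem t (hcone' t ht)).1
  have hdet0 := M.det3_conicCurve_ne_zero hE hcone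
  have hreg : deriv (M.conicCurve E) 0 ≠ 0 := fun h => by
    apply hdet0
    rw [h]
    simp [det3_eq]
  have hC2 := M.contDiffAt_conicCurve hcone
  refine ⟨M.conicCurve E, ⟨hc0, hC2, hreg, hsurf, ?_⟩,
    (Model.geodesicCurvature_ne_zero_iff hC2 hsurf hreg).2 hdet0, δ, hδ0, ?_⟩
  · filter_upwards [Ioo_mem_nhdsGT hδ0] with ε hε
    have hpar : ∀ᶠ x in 𝓝 O, conicParam E x ∈ Set.Ioo (-ε) ε := by
      have h1 := continuousAt_conicParam hE
      have h2 := conicParam_base hE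
      rw [hEO] at h1 h2
      refine h1.eventually (Ioo_mem_nhds ?_ ?_)
      · rw [h2]; exact neg_lt_zero.2 hε.1
      · rw [h2]; exact hε.1
    filter_upwards [hloc, hpar] with x hx hx'
    refine propext ⟨?_, fun h => ⟨_, hx', (hx h).symm⟩⟩
    rintro ⟨t, ht, rfl⟩
    exact hmem t (hcone' t ⟨by linarith [ht.1, hε.2], ht.2.trans hε.2⟩)
  · intro s hs t ht u hu hst htu hus
    exact M.tangentIncidenceAt_conicCurve hE hδ1 hδ (abs_lt.2 hs) (abs_lt.2 ht) (abs_lt.2 hu)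
      (fun h => hst (h ▸ rfl)) (fun h => htu (h ▸ rfl)) (fun h => hus (h ▸ rfl))

/-! ### Positive incidence numbers and Ceva's identity -/

theorem pos_of_deriv_deriv_pos {f f' f'' : ℝ → ℝ} {a b s t : ℝ} (hs : s ∈ Set.Ioo a b)
    (ht : t ∈ Set.Ioo a b) (hst : s ≠ t) (hf : ∀ x ∈ Set.Ioo a b, HasDerivAt f (f' x) x)
    (hf' : ∀ x ∈ Set.Ioo a b, HasDerivAt f' (f'' x) x) (hpos : ∀ x ∈ Set.Ioo a b, 0 < f'' x)
    (h0 : f s = 0) (h1 : f' s = 0) : 0 < f t := by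
  have hmono : StrictMonoOn f' (Set.Ioo a b) := by
    refine strictMonoOn_of_deriv_pos (convex_Ioo a b)
      (fun x hx => (hf' x hx).continuousAt.continuousWithinAt) fun x hx => ?_
    rw [interior_Ioo] at hx
    rw [(hf' x hx).deriv]
    exact hpos x hx
  have hsub : ∀ x y, x ∈ Set.Ioo a b → y ∈ Set.Ioo a b → Set.Icc x y ⊆ Set.Ioo a b :=
    fun x y hx hy z hz => ⟨hx.1.trans_le hz.1, hz.2.trans_lt hy.2⟩
  rcases lt_or_gt_of_ne hst with h | h
  · obtain ⟨q, hq, hq'⟩ := exists_hasDerivAt_eq_slope f f' h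
      (fun x hx => (hf x (hsub s t hs ht hx)).continuousAt.continuousWithinAt)
      (fun x hx => hf x (hsub s t hs ht (Set.Ioo_subset_Icc_self hx)))
    have h2 := hmono hs (hsub s t hs ht (Set.Ioo_subset_Icc_self hq)) hq.1
    rw [h1, hq', h0, sub_zero, div_pos_iff_of_pos_right (sub_pos.2 h)] at h2
    exact h2
  · obtain ⟨q, hq, hq'⟩ := exists_hasDerivAt_eq_slope f f' h
      (fun x hx => (hf x (hsub t s ht hs hx)).continuousAt.continuousWithinAt)
      (fun x hx => hf x (hsub t s ht hs (Set.Ioo_subset_Icc_self hx)))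
    have h2 := hmono (hsub t s ht hs (Set.Ioo_subset_Icc_self hq)) hs hq.2
    rw [h1, hq', h0, zero_sub, div_lt_iff₀ (sub_pos.2 h), zero_mul, neg_lt_zero] at h2
    exact h2

/-- With zero diagonal only the two 3-cycles survive in the determinant of the product matrix, and
both contribute positively. -/
theorem det_ne_zero_of_dotProduct_pos {p q : Fin 3 → Fin 3 → ℝ} (hdiag : ∀ i, p i ⬝ᵥ q i = 0)
    (hoff : ∀ i j, i ≠ j → 0 < p i ⬝ᵥ q j) :
    (Matrix.of p).det ≠ 0 ∧ (Matrix.of q).det ≠ 0 := by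
  have h : (Matrix.of p * (Matrix.of q)ᵀ).det =
      (p 0 ⬝ᵥ q 1) * (p 1 ⬝ᵥ q 2) * (p 2 ⬝ᵥ q 0) + (p 0 ⬝ᵥ q 2) * (p 1 ⬝ᵥ q 0) * (p 2 ⬝ᵥ q 1) := by
    have he : ∀ i j, (Matrix.of p * (Matrix.of q)ᵀ) i j = p i ⬝ᵥ q j := fun i j => rfl
    rw [det_fin_three]
    simp only [he, hdiag]
    ring
  have hpos : 0 < (Matrix.of p * (Matrix.of q)ᵀ).det := by
    rw [h]
    have h01 := hoff 0 1 (by decide)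
    have h12 := hoff 1 2 (by decide)
    have h20 := hoff 2 0 (by decide)
    have h02 := hoff 0 2 (by decide)
    have h10 := hoff 1 0 (by decide)
    have h21 := hoff 2 1 (by decide)
    positivity
  rw [det_mul, det_transpose] at hpos
  exact ⟨left_ne_zero_of_mul hpos.ne', right_ne_zero_of_mul hpos.ne'⟩

theorem det_ne_zero_of_pos {ι : Type*} {l c : ι → Fin 3 → ℝ} {I : Set ι}
    (hdiag : ∀ s ∈ I, l s ⬝ᵥ c s = 0) (hpos : ∀ s ∈ I, ∀ t ∈ I, s ≠ t → 0 < l s ⬝ᵥ c t) {s t u : ι}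
    (hs : s ∈ I) (ht : t ∈ I) (hu : u ∈ I) (hst : s ≠ t) (htu : t ≠ u) (hus : u ≠ s) :
    (Matrix.of ![l s, l t, l u]).det ≠ 0 ∧ (Matrix.of ![c s, c t, c u]).det ≠ 0 := by
  apply det_ne_zero_of_dotProduct_pos
  · intro i
    fin_cases i
    · exact hdiag s hs
    · exact hdiag t ht
    · exact hdiag u hu
  · intro i j hij
    fin_cases i <;> fin_cases j
    · exact absurd rfl hij
    · exact hpos s hs t ht hst
    · exact hpos s hs u hu hus.symm
    · exact hpos t ht s hs hst.symm
    · exact absurd rfl hij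
    · exact hpos t ht u hu htu
    · exact hpos u hu s hs hus
    · exact hpos u hu t ht htu.symm
    · exact absurd rfl hij

theorem dotProduct_eq_zero_of_mem_geodesic {M : Model} {l a b Y : Fin 3 → ℝ} (ha : l ⬝ᵥ a = 0)
    (hb : l ⬝ᵥ b = 0) (hY : Y ∈ M.geodesic a b) : l ⬝ᵥ Y = 0 := by
  obtain ⟨α, β, rfl⟩ := Submodule.mem_span_pair.1 hY.2
  simp [ha, hb]

/-- Two linear forms vanishing at `A` have a constant ratio along any line through `A`. -/
theorem mul_dotProduct_eq_of_mem_geodesic {M : Model} {l m A b X : Fin 3 → ℝ} (hl : l ⬝ᵥ A = 0)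
    (hm : m ⬝ᵥ A = 0) (hX : X ∈ M.geodesic A b) :
    (l ⬝ᵥ X) * (m ⬝ᵥ b) = (m ⬝ᵥ X) * (l ⬝ᵥ b) := by
  obtain ⟨α, β, rfl⟩ := Submodule.mem_span_pair.1 hX.2
  simp [hl, hm]
  ring

/-- The theorem of Ceva for the tangent triangle. -/
theorem Model.TangentIncidenceAt.ceva {M : Model} {c : ℝ → Fin 3 → ℝ} {l : ℝ → Fin 3 → ℝ}
    {I : Set ℝ} (hdiag : ∀ s ∈ I, l s ⬝ᵥ c s = 0) (hvel : ∀ s ∈ I, l s ⬝ᵥ deriv c s = 0)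
    (hpos : ∀ s ∈ I, ∀ t ∈ I, s ≠ t → 0 < l s ⬝ᵥ c t) {s t u : ℝ}
    (hs : s ∈ I) (ht : t ∈ I) (hu : u ∈ I) (hst : s ≠ t) (htu : t ≠ u) (hus : u ≠ s)
    (h : M.TangentIncidenceAt c s t u) :
    (l t ⬝ᵥ c s) * (l u ⬝ᵥ c t) * (l s ⬝ᵥ c u) = (l u ⬝ᵥ c s) * (l s ⬝ᵥ c t) * (l t ⬝ᵥ c u) := by
  obtain ⟨A, B, C, X, hA, hB, hC, hX⟩ := h
  have hX0 : X ≠ 0 := M.ne_zero_of_mem_surface hX.1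
  have hLdet := (det_ne_zero_of_pos hdiag hpos hs ht hu hst htu hus).1
  have tan : ∀ a ∈ I, ∀ Y ∈ M.geodesic (c a) (deriv c a), l a ⬝ᵥ Y = 0 := fun a ha Y hY =>
    dotProduct_eq_zero_of_mem_geodesic (hdiag a ha) (hvel a ha) hY
  have e1 := mul_dotProduct_eq_of_mem_geodesic (tan t ht A hA.mem.1) (tan u hu A hA.mem.2)
    hX.mem.1.1
  have e2 := mul_dotProduct_eq_of_mem_geodesic (tan u hu B hB.mem.1) (tan s hs B hB.mem.2)
    hX.mem.1.2
  have e3 := mul_dotProduct_eq_of_mem_geodesic (tan s hs C hC.mem.1) (tan t ht C hC.mem.2)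
    hX.mem.2
  have n1 := hpos t ht s hs hst.symm
  have n2 := hpos u hu t ht htu.symm
  have n3 := hpos s hs u hu hus.symm
  have n4 := hpos u hu s hs hus
  have n5 := hpos s hs t ht hst
  have n6 := hpos t ht u hu htu
  have hne : ¬ (l s ⬝ᵥ X = 0 ∧ l t ⬝ᵥ X = 0 ∧ l u ⬝ᵥ X = 0) := by
    rintro ⟨h1, h2, h3⟩
    apply hLdet
    refine exists_mulVec_eq_zero_iff.1 ⟨X, hX0, ?_⟩
    funext i
    fin_cases i
    · exact h1
    · exact h2
    · exact h3
  -- If `X` lay on one side of the tangent triangle, the ratio equations would put it on all three.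
  have hsX : l s ⬝ᵥ X ≠ 0 := fun h0 => by
    rw [h0, zero_mul, mul_eq_zero, or_iff_left n5.ne'] at e2
    rw [e2, zero_mul, mul_eq_zero, or_iff_left n4.ne'] at e1
    exact hne ⟨h0, e1, e2⟩
  have htX : l t ⬝ᵥ X ≠ 0 := fun h0 => by
    rw [h0, zero_mul, mul_eq_zero, or_iff_left n6.ne'] at e3
    exact hsX e3
  have huX : l u ⬝ᵥ X ≠ 0 := fun h0 => by
    rw [h0, zero_mul, mul_eq_zero, or_iff_left n4.ne'] at e1
    exact htX e1
  apply mul_left_cancel₀ (mul_ne_zero (mul_ne_zero hsX htX) huX)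
  linear_combination (-(l s ⬝ᵥ X) * (l u ⬝ᵥ X) * (l s ⬝ᵥ c t) * (l t ⬝ᵥ c u)) * e1
    - (l u ⬝ᵥ X) * (l t ⬝ᵥ c s) * (l s ⬝ᵥ X) * (l t ⬝ᵥ c u) * e2
    - (l s ⬝ᵥ X) * (l u ⬝ᵥ X) * (l t ⬝ᵥ c s) * (l u ⬝ᵥ c t) * e3

/-! ### From Ceva's identity to a conic -/

/-- A family of points and lines with symmetric incidence numbers is polar with respect to a
nondegenerate conic. -/
theorem exists_conic_of_symm {l c : ℝ → Fin 3 → ℝ} {I : Set ℝ}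
    (hdiag : ∀ s ∈ I, l s ⬝ᵥ c s = 0) (hpos : ∀ s ∈ I, ∀ t ∈ I, s ≠ t → 0 < l s ⬝ᵥ c t)
    (hsymm : ∀ s ∈ I, ∀ t ∈ I, l s ⬝ᵥ c t = l t ⬝ᵥ c s) {t₁ t₂ t₃ : ℝ}
    (h₁ : t₁ ∈ I) (h₂ : t₂ ∈ I) (h₃ : t₃ ∈ I) (h₁₂ : t₁ ≠ t₂) (h₂₃ : t₂ ≠ t₃) (h₃₁ : t₃ ≠ t₁) :
    ∃ S : Matrix (Fin 3) (Fin 3) ℝ, S.IsSymm ∧ S.det ≠ 0 ∧ ∀ s ∈ I, S.mulVec (c s) ⬝ᵥ c s = 0 := by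
  obtain ⟨hL, hA⟩ := det_ne_zero_of_pos hdiag hpos h₁ h₂ h₃ h₁₂ h₂₃ h₃₁
  set L := Matrix.of ![l t₁, l t₂, l t₃] with hLdef
  set A := Matrix.of ![c t₁, c t₂, c t₃] with hAdef
  have hAu : IsUnit A.det := isUnit_iff_ne_zero.2 hA
  have hAL : ∀ s ∈ I, A.mulVec (l s) = L.mulVec (c s) := fun s hs => by
    funext i
    fin_cases i
    · exact (dotProduct_comm _ _).trans (hsymm s hs t₁ h₁)
    · exact (dotProduct_comm _ _).trans (hsymm s hs t₂ h₂)
    · exact (dotProduct_comm _ _).trans (hsymm s hs t₃ h₃)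
  -- Three sample parameters define the matrix; symmetry of the incidence numbers makes it send
  -- every point to its tangent.
  have hS : ∀ s ∈ I, (A⁻¹ * L).mulVec (c s) = l s := fun s hs => by
    rw [← mulVec_mulVec, ← hAL s hs, mulVec_mulVec, nonsing_inv_mul _ hAu, one_mulVec]
  have hSA : A⁻¹ * L * Aᵀ = Lᵀ := by
    ext i j
    have h (s : ℝ) (hs : s ∈ I) : (A⁻¹ * L).mulVec (c s) i = l s i := by rw [hS s hs]
    fin_cases j
    · exact h t₁ h₁
    · exact h t₂ h₂
    · exact h t₃ h₃
  -- The transpose agrees with the matrix itself on the three independent sample points, hence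
  -- symmetry.
  have hSA' : (A⁻¹ * L)ᵀ * Aᵀ = Lᵀ := by
    rw [← transpose_mul, mul_nonsing_inv_cancel_left _ _ hAu]
  refine ⟨A⁻¹ * L, ?_, ?_, fun s hs => by rw [hS s hs, hdiag s hs]⟩
  · have h := congrArg (· * Aᵀ⁻¹) (hSA'.trans hSA.symm)
    have hAu' : IsUnit Aᵀ.det := by rwa [det_transpose]
    rw [IsSymm]
    simpa only [mul_nonsing_inv_cancel_right _ _ hAu'] using h
  · rw [det_mul, det_nonsing_inv]
    exact mul_ne_zero (by simpa using hA) hL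

/-- Ceva's identity with `u` fixed says exactly that the rescaled incidence numbers are symmetric.
At `u` itself the scaling factor is `0/0`, hence the removal of `u`. -/
theorem exists_conic_of_ceva {l c : ℝ → Fin 3 → ℝ} {I : Set ℝ}
    (hdiag : ∀ s ∈ I, l s ⬝ᵥ c s = 0) (hpos : ∀ s ∈ I, ∀ t ∈ I, s ≠ t → 0 < l s ⬝ᵥ c t)
    (hceva : ∀ s ∈ I, ∀ t ∈ I, ∀ u ∈ I, s ≠ t → t ≠ u → u ≠ s →
      (l t ⬝ᵥ c s) * (l u ⬝ᵥ c t) * (l s ⬝ᵥ c u) = (l u ⬝ᵥ c s) * (l s ⬝ᵥ c t) * (l t ⬝ᵥ c u))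
    {u t₁ t₂ t₃ : ℝ} (hu : u ∈ I)
    (h₁ : t₁ ∈ I \ {u}) (h₂ : t₂ ∈ I \ {u}) (h₃ : t₃ ∈ I \ {u}) (h₁₂ : t₁ ≠ t₂) (h₂₃ : t₂ ≠ t₃)
    (h₃₁ : t₃ ≠ t₁) :
    ∃ S : Matrix (Fin 3) (Fin 3) ℝ, S.IsSymm ∧ S.det ≠ 0 ∧
      ∀ s ∈ I \ {u}, S.mulVec (c s) ⬝ᵥ c s = 0 := by
  have hψ : ∀ s ∈ I \ {u}, 0 < l s ⬝ᵥ c u ∧ 0 < l u ⬝ᵥ c s := fun s hs =>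
    ⟨hpos s hs.1 u hu hs.2, hpos u hu s hs.1 (Ne.symm hs.2)⟩
  refine exists_conic_of_symm (l := fun s => ((l u ⬝ᵥ c s) / (l s ⬝ᵥ c u)) • l s) ?_ ?_ ?_
    h₁ h₂ h₃ h₁₂ h₂₃ h₃₁
  · intro s hs
    simp [hdiag s hs.1]
  · intro s hs t ht hst
    rw [smul_dotProduct]
    exact mul_pos (div_pos (hψ s hs).2 (hψ s hs).1) (hpos s hs.1 t ht.1 hst)
  · intro s hs t ht
    rcases eq_or_ne s t with rfl | hst
    · rfl
    have h1 := hceva s hs.1 t ht.1 u hu hst ht.2 (Ne.symm hs.2)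
    have hs' := (hψ s hs).1.ne'
    have ht' := (hψ t ht).1.ne'
    rw [smul_dotProduct, smul_dotProduct, smul_eq_mul, smul_eq_mul]
    field_simp
    linear_combination -h1

/-! ### Local convexity and the converse -/

theorem hasDerivAt_dotProduct {c : ℝ → Fin 3 → ℝ} {v : Fin 3 → ℝ} {t : ℝ} (l : Fin 3 → ℝ)
    (h : HasDerivAt c v t) : HasDerivAt (fun s => l ⬝ᵥ c s) (l ⬝ᵥ v) t := by
  have hi := hasDerivAt_pi.1 h
  simp only [vec3_dotProduct]
  exact (((hi 0).const_mul (l 0)).add ((hi 1).const_mul (l 1))).add ((hi 2).const_mul (l 2))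

/-- Near a point where position, velocity and acceleration are independent, the curve lies on one
side of each of its tangent planes. -/
theorem exists_forall_dotProduct_pos {c : ℝ → Fin 3 → ℝ} (hc : ContDiffAt ℝ 2 c 0)
    (hdet : det3 (c 0) (deriv c 0) (deriv (deriv c) 0) ≠ 0) :
    ∃ l : ℝ → Fin 3 → ℝ, (∀ s, l s ⬝ᵥ c s = 0) ∧ (∀ s, l s ⬝ᵥ deriv c s = 0) ∧
      ∃ ε > 0, ∀ s ∈ Set.Ioo (-ε) ε, ∀ t ∈ Set.Ioo (-ε) ε, s ≠ t → 0 < l s ⬝ᵥ c t := by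
  set D := det3 (c 0) (deriv c 0) (deriv (deriv c) 0) with hD
  -- The factor `D` fixes the sign: the second derivative of `l s ⬝ᵥ c x` in `x` equals `D² > 0` at
  -- `s = x = 0`, and stays positive nearby by joint continuity.
  refine ⟨fun s => D • crossProduct (c s) (deriv c s), fun s => ?_, fun s => ?_, ?_⟩
  · rw [smul_dotProduct, dotProduct_comm, dot_self_cross, smul_zero]
  · rw [smul_dotProduct, dotProduct_comm, dot_cross_self, smul_zero]
  have hcont : ContinuousAt (fun p : ℝ × ℝ => D * det3 (c p.1) (deriv c p.1) (deriv (deriv c) p.2))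
      ((0 : ℝ), (0 : ℝ)) := by
    have h0 (i : Fin 3) : ContinuousAt (fun p : ℝ × ℝ => c p.1 i) ((0 : ℝ), (0 : ℝ)) :=
      ContinuousAt.comp (f := Prod.fst) (g := fun s => c s i)
        ((continuous_apply i).continuousAt.comp hc.continuousAt) continuousAt_fst
    have h1 (i : Fin 3) : ContinuousAt (fun p : ℝ × ℝ => deriv c p.1 i) ((0 : ℝ), (0 : ℝ)) :=
      ContinuousAt.comp (f := Prod.fst) (g := fun s => deriv c s i)
        ((continuous_apply i).continuousAt.comp (contDiffAt_one_deriv hc).continuousAt)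
        continuousAt_fst
    have h2 (i : Fin 3) : ContinuousAt (fun p : ℝ × ℝ => deriv (deriv c) p.2 i)
        ((0 : ℝ), (0 : ℝ)) :=
      ContinuousAt.comp (f := Prod.snd) (g := fun s => deriv (deriv c) s i)
        ((continuous_apply i).continuousAt.comp (continuousAt_deriv_deriv hc)) continuousAt_snd
    simp only [det3_eq]
    exact continuousAt_const.mul
      ((((((h0 1).mul (h1 2)).sub ((h0 2).mul (h1 1))).mul (h2 0)).add
        ((((h0 2).mul (h1 0)).sub ((h0 0).mul (h1 2))).mul (h2 1))).add
        ((((h0 0).mul (h1 1)).sub ((h0 1).mul (h1 0))).mul (h2 2)))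
  have hev : ∀ᶠ p in 𝓝 ((0 : ℝ), (0 : ℝ)),
      0 < D * det3 (c p.1) (deriv c p.1) (deriv (deriv c) p.2) :=
    hcont.eventually (lt_mem_nhds (mul_self_pos.2 hdet))
  obtain ⟨ε₁, hε₁, h1⟩ := Metric.eventually_nhds_iff.1 hev
  obtain ⟨ε₂, hε₂, h2⟩ := Metric.eventually_nhds_iff.1 (eventually_contDiffAt hc)
  have habs {x : ℝ} (hx : x ∈ Set.Ioo (-(min ε₁ ε₂)) (min ε₁ ε₂)) : |x| < ε₁ ∧ |x| < ε₂ :=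
    lt_min_iff.1 (abs_lt.2 hx)
  have hC {x : ℝ} (hx : x ∈ Set.Ioo (-(min ε₁ ε₂)) (min ε₁ ε₂)) : ContDiffAt ℝ 2 c x :=
    h2 (by rw [Real.dist_eq, sub_zero]; exact (habs hx).2)
  refine ⟨min ε₁ ε₂, lt_min hε₁ hε₂, fun s hs t ht hst => ?_⟩
  refine pos_of_deriv_deriv_pos (f := fun x => (D • crossProduct (c s) (deriv c s)) ⬝ᵥ c x)
    hs ht hst
    (fun x hx => hasDerivAt_dotProduct _ (hasDerivAt_deriv (hC hx)).1)
    (fun x hx => hasDerivAt_dotProduct _ (hasDerivAt_deriv (hC hx)).2) (fun x hx => ?_) ?_ ?_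
  · rw [smul_dotProduct]
    refine h1 (y := (s, x)) ?_
    rw [Prod.dist_eq, max_lt_iff]
    simp only [Real.dist_eq, sub_zero]
    exact ⟨(habs hs).1, (habs hx).1⟩
  · rw [smul_dotProduct, dotProduct_comm, dot_self_cross, smul_zero]
  · rw [smul_dotProduct, dotProduct_comm, dot_cross_self, smul_zero]

/-- The germ of a regular `C²` curve contained in a nondegenerate conic is the germ of the conic. -/
theorem Model.IsC2Param.eventuallyEq_conic {M : Model} {γ : Set (Fin 3 → ℝ)} {O : Fin 3 → ℝ}
    {c : ℝ → Fin 3 → ℝ} (hc : M.IsC2Param γ O c) {S : Matrix (Fin 3) (Fin 3) ℝ} (hS : S.IsSymm)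
    (hdet : S.det ≠ 0) (hmem : ∀ᶠ t in 𝓝 (0 : ℝ), c t ∈ M.conic S) : γ =ᶠ[𝓝 O] M.conic S := by
  have hO : O ∈ M.conic S := hc.base ▸ hmem.self_of_nhds
  obtain ⟨E, hE, hEO, h0, hc0, -, hloc⟩ := M.exists_conicCurve hS hdet hO
  have hcone : quadCurve E 0 ∈ M.cone := h0 ▸ M.mem_cone hO.1
  have hcO : Tendsto c (𝓝 0) (𝓝 O) := by
    have := hc.contDiffAt.continuousAt
    rwa [ContinuousAt, hc.base] at this
  have hparO := continuousAt_conicParam hE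
  have hpar0 := conicParam_base hE
  rw [hEO] at hparO hpar0
  have hcurve : ∀ᶠ t in 𝓝 (0 : ℝ), c t = M.conicCurve E (conicParam E (c t)) := by
    filter_upwards [hmem, hcO.eventually hloc] with t h1 h2 using h2 h1
  have hτ : ContDiffAt ℝ 1 (fun t => conicParam E (c t)) 0 := by
    have h1 : ContDiffAt ℝ 1 c 0 := hc.contDiffAt.of_le (by norm_num)
    have h2 (i : Fin 3) : ContDiffAt ℝ 1 (fun t => (E⁻¹.mulVec (c t)) i) 0 := by
      have h3 (j : Fin 3) : ContDiffAt ℝ 1 (fun t => c t j) 0 := contDiffAt_pi.1 h1 j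
      simp only [mulVec, vec3_dotProduct]
      exact ((contDiffAt_const.mul (h3 0)).add (contDiffAt_const.mul (h3 1))).add
        (contDiffAt_const.mul (h3 2))
    refine (h2 1).div (h2 0) ?_
    rw [hc.base, ← hEO, inv_mulVec_mulVec hE]
    simp
  have hτ' := hτ.hasStrictDerivAt (by norm_num)
  -- By the chain rule a zero here would force `c' = 0` at the base point. Hence the conic parameter
  -- along `c` fills a neighbourhood of `0`, and `c` misses no nearby point of the conic.
  have hτ0 : deriv (fun t => conicParam E (c t)) 0 ≠ 0 := by
    intro h
    apply hc.regular
    have h1 : HasDerivAt (M.conicCurve E) (deriv (M.conicCurve E) 0) (conicParam E (c 0)) := by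
      rw [hc.base, hpar0]
      exact ((M.contDiffAt_conicCurve hcone).differentiableAt (by norm_num)).hasDerivAt
    have h2 := h1.scomp (0 : ℝ) hτ'.hasDerivAt
    have h3 : c =ᶠ[𝓝 0] M.conicCurve E ∘ fun t => conicParam E (c t) := hcurve
    rw [h3.deriv_eq, h2.deriv, h, zero_smul]
  have hmap := hτ'.map_nhds_eq hτ0
  rw [hc.base, hpar0] at hmap
  obtain ⟨ε, hε, hε'⟩ := Metric.eventually_nhds_iff.1 (hmem.and hcurve)
  obtain ⟨δ, ⟨hδ, hδε⟩, hδ0⟩ :=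
    ((hc.germ_eq.and (Ioo_mem_nhdsGT hε)).and self_mem_nhdsWithin).exists
  have hδ0 : 0 < δ := hδ0
  have hI {t : ℝ} (ht : t ∈ Set.Ioo (-δ) δ) :
      c t ∈ M.conic S ∧ c t = M.conicCurve E (conicParam E (c t)) :=
    hε' (by rw [Real.dist_eq, sub_zero]; exact (abs_lt.2 ht).trans hδε.2)
  refine hδ.symm.trans ?_
  have himage : (fun t => conicParam E (c t)) '' Set.Ioo (-δ) δ ∈ 𝓝 (0 : ℝ) := by
    rw [← hmap]
    exact image_mem_map (Ioo_mem_nhds (neg_lt_zero.2 hδ0) hδ0)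
  have hnear : ∀ᶠ x in 𝓝 O,
      conicParam E x ∈ (fun t => conicParam E (c t)) '' Set.Ioo (-δ) δ := by
    refine hparO.eventually ?_
    rw [hpar0]
    exact himage
  filter_upwards [hloc, hnear] with x hx hx'
  refine propext ⟨?_, fun h => ?_⟩
  · rintro ⟨t, ht, rfl⟩
    exact (hI ht).1
  · obtain ⟨t, ht, hxt⟩ := hx'
    refine ⟨t, ht, ?_⟩
    rw [hx h, ← hxt]
    exact (hI ht).2

theorem Model.HasTangentIncidence.exists_conic {M : Model} {γ : Set (Fin 3 → ℝ)} {O : Fin 3 → ℝ}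
    (h : M.HasTangentIncidence γ O) :
    ∃ C : Matrix (Fin 3) (Fin 3) ℝ, C.IsSymm ∧ C.det ≠ 0 ∧ γ =ᶠ[𝓝 O] M.conic C := by
  obtain ⟨c, hc, hcurv, δ, hδ, hinc⟩ := h
  rw [Model.geodesicCurvature_ne_zero_iff hc.contDiffAt hc.mem_surface hc.regular] at hcurv
  obtain ⟨l, hdiag, hvel, ε, hε, hpos⟩ := exists_forall_dotProduct_pos hc.contDiffAt hcurv
  obtain ⟨η, hη, hηε, hηδ⟩ : ∃ η > 0, η ≤ ε ∧ η ≤ δ :=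
    ⟨min ε δ, lt_min hε hδ, min_le_left _ _, min_le_right _ _⟩
  have hsubε : Set.Ioo (-η) η ⊆ Set.Ioo (-ε) ε := Set.Ioo_subset_Ioo (neg_le_neg hηε) hηε
  have hsubδ : Set.Ioo (-η) η ⊆ Set.Ioo (-δ) δ := Set.Ioo_subset_Ioo (neg_le_neg hηδ) hηδ
  have hpos' : ∀ s ∈ Set.Ioo (-η) η, ∀ t ∈ Set.Ioo (-η) η, s ≠ t → 0 < l s ⬝ᵥ c t :=
    fun s hs t ht => hpos s (hsubε hs) t (hsubε ht)
  have hinj : ∀ s ∈ Set.Ioo (-η) η, ∀ t ∈ Set.Ioo (-η) η, s ≠ t → c s ≠ c t :=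
    fun s hs t ht hst he => by
      have h1 := hpos' s hs t ht hst
      rw [← he, hdiag s] at h1
      exact lt_irrefl _ h1
  have hmemI {x : ℝ} (h1 : -η < x) (h2 : x < η / 2) : x ∈ Set.Ioo (-η) η \ {η / 2} :=
    ⟨⟨h1, by linarith⟩, h2.ne⟩
  obtain ⟨S, hS, hdet, hSc⟩ := exists_conic_of_ceva (fun s _ => hdiag s) hpos'
    (fun s hs t ht u hu hst htu hus =>
      (hinc s (hsubδ hs) t (hsubδ ht) u (hsubδ hu) (hinj s hs t ht hst) (hinj t ht u hu htu)
        (hinj u hu s hs hus)).ceva (fun s _ => hdiag s) (fun s _ => hvel s) hpos' hs ht hu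
        hst htu hus)
    -- The excluded parameter `u` is placed away from `0`, so that `(-η, η/2)` is still a
    -- neighbourhood of `0`.
    (u := η / 2) (t₁ := -(η / 4)) (t₂ := 0) (t₃ := η / 4) ⟨by linarith, by linarith⟩
    (hmemI (by linarith) (by linarith)) (hmemI (by linarith) (by linarith))
    (hmemI (by linarith) (by linarith)) (by linarith) (by linarith) (by linarith)
  refine ⟨S, hS, hdet, hc.eventuallyEq_conic hS hdet ?_⟩
  filter_upwards [hc.mem_surface, Ioo_mem_nhds (neg_lt_zero.2 hη) (half_pos hη)] with t h1 h2
  exact ⟨h1, hSc t (hmemI h2.1 h2.2)⟩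

end ConstCurv

theorem theorem4p9 (M : ConstCurv.Model) :
    (∀ C : Matrix (Fin 3) (Fin 3) ℝ, C.IsSymm → C.det ≠ 0 →
      ∀ O ∈ M.conic C, M.HasTangentIncidence (M.conic C) O) ∧
    (∀ (γ : Set (Fin 3 → ℝ)) (O : Fin 3 → ℝ), M.HasTangentIncidence γ O →
      ∃ C : Matrix (Fin 3) (Fin 3) ℝ, C.IsSymm ∧ C.det ≠ 0 ∧ γ =ᶠ[𝓝 O] M.conic C) :=
  ⟨fun _ hC hdet _ hO => M.hasTangentIncidence_conic hC hdet hO, fun _ _ h => h.exists_conic⟩
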